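/- Throughout, a monoid is a commutative cancellative semigroup with identity. Let $H$ be a monoid with quotient group $K$ and unit group $H^\times$; let $\mathcal A(H)$ be its set of atoms (non-units that are not a product of two non-units). For a non-unit $a\in H$ let $\mathsf L(a)$ be the set of all $k\in\mathbb N$ such that $a$ is a product of $k$ atoms, and let $\mathsf L(a)=\{0\}$ for $a\in H^\times$. The monoid $H$ is \emph{half-factorial} if every non-unit is a finite product of atoms and $|\mathsf L(a)|=1$ for all $a\in H$. A non-unit $a$ is \emph{primary} if $a\mid bc$ and $a\nmid b$ imply $a\mid c^n$ for some $n\in\mathbb N$; $H$ is \emph{weakly factorial} if every non-unit is a finite product of primary elements. Let $\widetilde H=\{x\in K\mid x^N\in H \text{ for some } N\in\mathbb N\}$ be the root closure of $H$; $H$ is \emph{seminormal} if every $x\in K$ such that $x^n\in H$ for all sufficiently large $n$ lies in $H$. For $A,B\subseteq K$ let $(A:B)=\{z\in K\mid zB\subseteq A\}$, $A_v=(H:(H:A))$ and $A_t=\bigcup_{E\subseteq A,\,|E|<\infty}E_v$; a \emph{$t$-ideal} of $H$ is a set $A\subseteq H$ with $A_t=A$. The monoid $H$ is \emph{Krull}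 if it satisfies the ascending chain condition on $t$-ideals and is completely integrally closed (every $x\in K$ for which there is $c\in H$ with $cx^n\in H$ for all $n\in\mathbb N$ lies in $H$). A homomorphism of monoids $\theta:H\to B$ is a \emph{transfer homomorphism} if $B=\theta(H)B^\times$, $\theta^{-1}(B^\times)=H^\times$, and whenever $\theta(u)=bc$ with $u\in H$, $b,c\in B$, there are $v,w\in H$ and $\varepsilon,\eta\in B^\times$ with $u=vw$, $\theta(v)=b\varepsilon$, $\theta(w)=c\eta$. The monoid $H$ is \emph{transfer Krull} if it admits a transfer homomorphism to some Krull monoid. A \emph{prime $s$-ideal} of $H$ is a set $P\subseteq H$ with $PH=P$ whose complement $H\setminus P$ is a submonoid; $\mathfrak X(H)$ is the set of minimal non-empty prime $s$-ideals, and $H_P=(H\setminus P)^{-1}H\subseteq K$. \textbf{Theorem.} Let $H$ be a weakly factorial monoid such that $\widetilde H$ is a Krull monoid. Then the following statements are equivalent. \begin{enumerate} \item[(1)] $H$ is transfer Krull. \item[(2)] For each $P\in\mathfrak X(H)$, $H_P$ is transfer Krull. \item[(3)] For each $P\in\mathfrak X(H)$, $H_P$ is half-factorial. \item[(4)] $H$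 is half-factorial. \item[(5)] $\mathcal A(\widetilde H)=\{u\varepsilon\mid u\in\mathcal A(H),\ \varepsilon\in\widetilde H^\times\}$. \item[(6)] $\mathcal A(H)\subseteq\mathcal A(\widetilde H)$. \end{enumerate} In addition, if $H$ is seminormal, then these equivalent conditions are satisfied. -/

import Mathlib

open scoped Pointwise

/-! Notions that make sense for an arbitrary commutative monoid. The monoids to which they are
applied below are submonoids of commutative groups, hence cancellative. Atoms are Mathlib's
`Irreducible` elements. -/

section Abstract

variable {M : Type*} [CommMonoid M]

/-- Every non-unit is a finite product of atoms. -/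
def IsAtomicMonoid (M : Type*) [CommMonoid M] : Prop :=
  ∀ a : M, ¬ IsUnit a → ∃ s : Multiset M, (∀ u ∈ s, Irreducible u) ∧ s.prod = a

/-- The set of lengths of `a`: it is `{0}` if `a` is a unit, and otherwise the set of all
positive `k` such that `a` is a product of `k` atoms. -/
def lengthSet (a : M) : Set ℕ :=
  {k | (IsUnit a ∧ k = 0) ∨
    (¬ IsUnit a ∧ 0 < k ∧
      ∃ s : Multiset M, s.card = k ∧ (∀ u ∈ s, Irreducible u) ∧ s.prod = a)}

/-- Atomic, and every set of lengths has exactly one element. -/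
def IsHalfFactorial (M : Type*) [CommMonoid M] : Prop :=
  IsAtomicMonoid M ∧ ∀ a : M, ∃! k : ℕ, k ∈ lengthSet a

/-- Primary elements of a monoid. -/
def IsPrimaryElement (a : M) : Prop :=
  ¬ IsUnit a ∧ ∀ b c : M, a ∣ b * c → ¬ a ∣ b → ∃ n : ℕ, 0 < n ∧ a ∣ c ^ n

/-- Every non-unit is a finite product of primary elements. -/
def IsWeaklyFactorial (M : Type*) [CommMonoid M] : Prop :=
  ∀ a : M, ¬ IsUnit a → ∃ s : Multiset M, (∀ q ∈ s, IsPrimaryElement q) ∧ s.prod = a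

/-- Transfer homomorphisms. -/
structure IsTransferHom {B : Type*} [CommMonoid B] (θ : M →* B) : Prop where
  /-- `B = θ(M) Bˣ` -/
  surj : ∀ b : B, ∃ (a : M) (ε : Bˣ), b = θ a * ε
  /-- `θ⁻¹(Bˣ) = Mˣ` -/
  isUnit_iff : ∀ a : M, IsUnit (θ a) ↔ IsUnit a
  /-- factorizations of `θ u` lift, up to units, to factorizations of `u` -/
  lift : ∀ (u : M) (b c : B), θ u = b * c →
    ∃ (v w : M) (ε η : Bˣ), u = v * w ∧ θ v = b * ε ∧ θ w = c * η

end Abstract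

/-! Notions for a monoid `H` that is given as a submonoid of its quotient group `K`. -/

section InQuotientGroup

variable {K : Type*} [CommGroup K]

/-- The commutative group `K` is a quotient group of its submonoid `H`. -/
def IsQuotientGroupOf (H : Submonoid K) : Prop :=
  ∀ x : K, ∃ a ∈ H, ∃ b ∈ H, x = a * b⁻¹

/-- The set of atoms of `H`, as a subset of `K`. -/
def atomSet (H : Submonoid K) : Set K :=
  (fun u : H => (u : K)) '' {u : H | Irreducible u}

/-- The group of units of `H`, as a subset of `K`. -/
def unitSet (H : Submonoid K) : Set K :=
  (fun u : H => (u : K)) '' {u : H | IsUnit u}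

/-- The root closure of `H`. -/
def rootClosure (H : Submonoid K) : Submonoid K where
  carrier := {x | ∃ N : ℕ, 0 < N ∧ x ^ N ∈ H}
  one_mem' := ⟨1, one_pos, by simp⟩
  mul_mem' := by
    rintro x y ⟨m, hm, hx⟩ ⟨n, hn, hy⟩
    refine ⟨m * n, Nat.mul_pos hm hn, ?_⟩
    rw [mul_pow, pow_mul, mul_comm m n, pow_mul]
    exact H.mul_mem (H.pow_mem hx n) (H.pow_mem hy m)

/-- The seminormal closure of `H`. -/
def seminormalClosure (H : Submonoid K) : Set K :=
  {x | ∃ N : ℕ, 0 < N ∧ ∀ n : ℕ, N ≤ n → x ^ n ∈ H}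

/-- `H` equals its seminormal closure. -/
def IsSeminormal (H : Submonoid K) : Prop :=
  (H : Set K) = seminormalClosure H

/-- The complete integral closure of `H`. -/
def completeIntClosure (H : Submonoid K) : Set K :=
  {x | ∃ c ∈ H, ∀ n : ℕ, 0 < n → c * x ^ n ∈ H}

/-- `H` equals its complete integral closure. -/
def IsCompletelyIntegrallyClosed (H : Submonoid K) : Prop :=
  (H : Set K) = completeIntClosure H

/-- The quotient `(A : B)` of subsets of `K`. -/
def setColon (A B : Set K) : Set K :=
  {z | ∀ b ∈ B, z * b ∈ A}

/-- `A_v = (H : (H : A))`. -/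
def vClosure (H : Submonoid K) (A : Set K) : Set K :=
  setColon H (setColon H A)

/-- `A_t`, the union of the sets `E_v` over all finite subsets `E` of `A`. -/
def tClosure (H : Submonoid K) (A : Set K) : Set K :=
  {x | ∃ E : Set K, E ⊆ A ∧ E.Finite ∧ x ∈ vClosure H E}

/-- `A` is a `t`-ideal of `H`. -/
def IsTIdeal (H : Submonoid K) (A : Set K) : Prop :=
  A ⊆ H ∧ tClosure H A = A

/-- The ascending chain condition on `t`-ideals. -/
def IsMori (H : Submonoid K) : Prop :=
  ∀ A : ℕ → Set K, (∀ n, IsTIdeal H (A n)) → (∀ n, A n ⊆ A (n + 1)) →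
    ∃ N, ∀ n, N ≤ n → A n = A N

/-- Krull monoids. -/
def IsKrull (H : Submonoid K) : Prop :=
  IsCompletelyIntegrallyClosed H ∧ IsMori H

/-- `P` is an `s`-ideal of `H`. -/
def IsSIdeal (H : Submonoid K) (P : Set K) : Prop :=
  P ⊆ H ∧ P * (H : Set K) = P

/-- `P` is a prime `s`-ideal of `H`: the complement `H \ P` is a submonoid.
The empty set is allowed. -/
structure IsPrimeSIdeal (H : Submonoid K) (P : Set K) : Prop where
  isSIdeal : IsSIdeal H P
  one_notMem : (1 : K) ∉ P
  mul_notMem : ∀ a ∈ H, ∀ b ∈ H, a ∉ P → b ∉ P → a * b ∉ P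

/-- `P` is a minimal non-empty prime `s`-ideal of `H`. -/
def IsMinimalPrimeSIdeal (H : Submonoid K) (P : Set K) : Prop :=
  Minimal (fun Q : Set K => IsPrimeSIdeal H Q ∧ Q.Nonempty) P

/-- The localization `H_P = (H \ P)⁻¹ H` inside `K`. -/
def localizationAt (H : Submonoid K) (P : Set K) (hP : IsPrimeSIdeal H P) : Submonoid K where
  carrier := {x | ∃ a ∈ H, ∃ s ∈ H, s ∉ P ∧ x = a * s⁻¹}
  one_mem' := ⟨1, H.one_mem, 1, H.one_mem, hP.one_notMem, by simp⟩
  mul_mem' := by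
    rintro x y ⟨a, ha, s, hs, hsP, rfl⟩ ⟨b, hb, t, ht, htP, rfl⟩
    refine ⟨a * b, H.mul_mem ha hb, s * t, H.mul_mem hs ht, hP.mul_notMem s hs t ht hsP htP, ?_⟩
    rw [mul_inv, mul_mul_mul_comm]

end InQuotientGroup

/-- Transfer Krull monoids: there is a transfer homomorphism to a Krull monoid `B`
(given as a submonoid of its quotient group `L`). -/
def IsTransferKrull.{u} (M : Type u) [CommMonoid M] : Prop :=
  ∃ (L : Type u) (_ : CommGroup L) (B : Submonoid L),
    IsQuotientGroupOf B ∧ IsKrull B ∧ ∃ θ : M →* B, IsTransferHom θ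

/-!
The proof rests on two facts.

In a weakly factorial monoid `H` every element is a product of primary elements, and the radicals
of primary elements are exactly the minimal non-empty primes
(`IsPrimaryElement.mem_radicalSet_symm`, `IsPrimaryElement.isMinimalPrimeSIdeal`). For a minimal
prime `P` with complement `S`, the units and the primary elements in `P` form a divisor-closed
submonoid `primaryComponent S`. Up to units it is the localization `H_P`
(`IsMinimalPrimeSIdeal.isReducedIso`), and in it every element divides a power of every non-unit
(`IsWeaklyFactorial.exists_dvd_pow`). Atoms are primary, so lengths of factorizations in `H` can be
compared one component at a time (`HasUniqueLengths.of_primaryComponent`), and half-factoriality of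
`H` is equivalent to half-factoriality of all `H_P`.

A divisor-closed submonoid `C` of a Krull monoid in which every element divides a power of every
non-unit is, up to units, generated by a single element `p` (`IsKrull.exists_uniformizer`). This
is used twice.

* Applied to the image of a primary component under a transfer homomorphism to a Krull monoid, it
  shows that the component has only one atom up to units there, so that its lengths are unique
  (`IsTransferKrull.hasUniqueLengths`). Conversely, the length function of a half-factorial monoid
  is a transfer homomorphism to the nonnegative integers (`IsHalfFactorial.isTransferKrull`).
* Applied to the elements of the root closure with a power in the primary component, it provides
  for each minimal prime a uniformizer `p`, which is an atom of the root closure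
  (`IsUniformizer`). If the atoms of `H` are atoms of the root closure, they are associated to
  uniformizers there, so lengths are unique (`IsUniformizer.hasUniqueLengths`), and every atom of
  the root closure is associated to an atom of `H` (`IsWeaklyFactorial.atomSet_rootClosure_eq`).
  Conversely, unique lengths force all atoms of a component to be associated to one power `p ^ n`,
  and `n = 1` because `p` is a quotient of elements of the component
  (`IsUniformizer.unitClass_eq_of_hasUniqueLengths`). For seminormal `H`, all non-units of the root
  closure that are quotients of elements of one component already lie in `H`, which again gives
  `n = 1` (`IsSeminormal.mul_inv_mem`, `IsUniformizer.unitClass_eq_of_isSeminormal`).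

Atomicity of `H` comes from the ascending chain condition on principal ideals of the root closure
(`IsKrull.isAtomicMonoid_of_rootClosure`).
-/

/-! ### Factorizations in cancellative monoids -/

section Lengths

variable {M : Type*} [CommMonoid M]

/-- Any two factorizations of associated elements into atoms of `M` lying in `D` have the same
length. -/
def HasUniqueLengths (D : Submonoid M) : Prop :=
  ∀ s t : Multiset M, (∀ u ∈ s, Irreducible u ∧ u ∈ D) → (∀ u ∈ t, Irreducible u ∧ u ∈ D) →
    Associated s.prod t.prod → s.card = t.card

theorem Multiset.eq_zero_of_isUnit_prod {s : Multiset M} (hs : ∀ u ∈ s, Irreducible u)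
    (h : IsUnit s.prod) : s = 0 := by
  refine Multiset.eq_zero_of_forall_notMem fun u hu => (hs u hu).not_isUnit ?_
  exact isUnit_of_dvd_unit (Multiset.dvd_prod hu) h

theorem Multiset.exists_irreducible_prod_eq {s : Multiset M} (hs : ∀ u ∈ s, Irreducible u) {a : M}
    (h : Associated s.prod a) (ha : ¬ IsUnit a) :
    ∃ t : Multiset M, t.card = s.card ∧ (∀ u ∈ t, Irreducible u) ∧ t.prod = a := by
  obtain ⟨ε, hε⟩ := h
  induction s using Multiset.induction_on with
  | empty => exact absurd (by simp [← hε]) ha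
  | cons u s _ =>
    refine ⟨(u * ε) ::ₘ s, by simp, ?_, ?_⟩
    · intro v hv
      rcases Multiset.mem_cons.1 hv with rfl | hv
      · exact (irreducible_mul_units ε).2 (hs u (Multiset.mem_cons_self u s))
      · exact hs v (Multiset.mem_cons_of_mem hv)
    · rw [← hε, Multiset.prod_cons, Multiset.prod_cons, mul_right_comm]

theorem isHalfFactorial_iff :
    IsHalfFactorial M ↔ IsAtomicMonoid M ∧ HasUniqueLengths (⊤ : Submonoid M) := by
  constructor
  · rintro ⟨hat, huniq⟩
    refine ⟨hat, fun s t hs ht hst => ?_⟩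
    have hs' : ∀ u ∈ s, Irreducible u := fun u hu => (hs u hu).1
    have ht' : ∀ u ∈ t, Irreducible u := fun u hu => (ht u hu).1
    by_cases h : IsUnit t.prod
    · rw [Multiset.eq_zero_of_isUnit_prod ht' h,
        Multiset.eq_zero_of_isUnit_prod hs' (hst.isUnit_iff.2 h)]
    · obtain ⟨s₁, hcard, hs₁, hprod⟩ := Multiset.exists_irreducible_prod_eq hs' hst h
      have key : ∀ r : Multiset M, (∀ u ∈ r, Irreducible u) → r.prod = t.prod →
          r.card ∈ lengthSet t.prod := by
        intro r hr hrt
        refine Or.inr ⟨h, Multiset.card_pos.2 ?_, r, rfl, hr, hrt⟩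
        rintro rfl
        exact h (by simp [← hrt])
      rw [← hcard]
      exact (huniq t.prod).unique (key s₁ hs₁ hprod) (key t ht' rfl)
  · rintro ⟨hat, huniq⟩
    refine ⟨hat, fun a => ?_⟩
    by_cases ha : IsUnit a
    · exact ⟨0, Or.inl ⟨ha, rfl⟩, fun k hk => hk.elim (·.2) fun h => absurd ha h.1⟩
    · obtain ⟨s, hs, rfl⟩ := hat a ha
      refine ⟨s.card, Or.inr ⟨ha, Multiset.card_pos.2 ?_, s, rfl, hs, rfl⟩, ?_⟩
      · rintro rfl
        simp at ha
      · rintro k (hk | ⟨-, -, t, rfl, ht, hts⟩)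
        · exact absurd hk.1 ha
        · exact huniq t s (fun u hu => ⟨ht u hu, trivial⟩) (fun u hu => ⟨hs u hu, trivial⟩)
            (hts ▸ Associated.refl _)

theorem associated_of_dvd_dvd_of_isCancelMul [IsCancelMul M] {a b : M} (hab : a ∣ b)
    (hba : b ∣ a) : Associated a b := by
  obtain ⟨c, rfl⟩ := hab
  obtain ⟨d, hd⟩ := hba
  have h : c * d = 1 := by
    have : a * (c * d) = a * 1 := by rw [mul_one, ← mul_assoc, ← hd]
    exact mul_left_cancel this
  exact ⟨⟨c, d, h, by rw [mul_comm, h]⟩, rfl⟩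

/-- A cancellative monoid in which proper divisibility is well-founded is atomic. -/
theorem IsAtomicMonoid.of_wellFounded
    (hwf : WellFounded fun a b : M => ∃ c, ¬ IsUnit c ∧ b = a * c) : IsAtomicMonoid M := by
  intro a
  induction a using hwf.induction with
  | _ a ih =>
    intro ha
    by_cases hirr : Irreducible a
    · exact ⟨{a}, by simpa using hirr, by simp⟩
    · have : ∃ b c, a = b * c ∧ ¬ IsUnit b ∧ ¬ IsUnit c := by
        by_contra! h
        refine hirr ⟨ha, fun b c hbc => ?_⟩
        by_cases hb : IsUnit b
        · exact Or.inl hb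
        · exact Or.inr (h b c hbc hb)
      obtain ⟨b, c, rfl, hb, hc⟩ := this
      obtain ⟨s, hs, rfl⟩ := ih b ⟨c, hc, rfl⟩ hb
      obtain ⟨t, ht, rfl⟩ := ih c ⟨_, hb, mul_comm _ _⟩ hc
      refine ⟨s + t, fun u hu => ?_, by simp⟩
      exact (Multiset.mem_add.1 hu).elim (hs u) (ht u)

end Lengths

/-! ### Primary elements and their components -/

section Primary

variable {M : Type*} [CommMonoid M]

/-- The radical of the principal ideal generated by `q`. The exponent `n = 0` is allowed; it is
only relevant for units `q`. -/
def radicalSet (q : M) : Set M :=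
  {x | ∃ n : ℕ, q ∣ x ^ n}

theorem self_mem_radicalSet (q : M) : q ∈ radicalSet q := ⟨1, by simp⟩

/-- The complement of the radical of a primary element is a submonoid. -/
def radicalCompl (q : M) (hq : IsPrimaryElement q) : Submonoid M where
  carrier := (radicalSet q)ᶜ
  one_mem' := by
    rintro ⟨n, hn⟩
    exact hq.1 (isUnit_of_dvd_one (by simpa using hn))
  mul_mem' := by
    rintro x y hx hy ⟨n, hn⟩
    rw [mul_pow] at hn
    obtain ⟨m, -, hm⟩ := hq.2 _ _ hn fun h => hx ⟨n, h⟩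
    exact hy ⟨n * m, by rwa [pow_mul]⟩

theorem radicalSet_subset_of_mem {p q : M} (h : q ∈ radicalSet p) :
    radicalSet q ⊆ radicalSet p := by
  rintro x ⟨n, hn⟩
  obtain ⟨m, hm⟩ := h
  exact ⟨n * m, hm.trans (by rw [pow_mul]; exact pow_dvd_pow_of_dvd hn m)⟩

theorem IsWeaklyFactorial.isPrimaryElement_of_irreducible (hwf : IsWeaklyFactorial M) {u : M}
    (hu : Irreducible u) : IsPrimaryElement u := by
  obtain ⟨m, hm, rfl⟩ := hwf u hu.not_isUnit
  obtain ⟨q, hq⟩ := Multiset.exists_mem_of_ne_zero (s := m) fun h => hu.not_isUnit (by simp [h])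
  obtain ⟨m, rfl⟩ := Multiset.exists_cons_of_mem hq
  rw [Multiset.prod_cons] at hu ⊢
  obtain ⟨ε, hε⟩ := (hu.isUnit_or_isUnit rfl).resolve_left (hm q hq).1
  rw [← hε]
  obtain ⟨hqu, hqp⟩ := hm q hq
  refine ⟨by simpa using hqu, fun b c => ?_⟩
  simpa only [Units.mul_right_dvd] using hqp b c

variable [IsCancelMul M]

/-- The relation "`q` lies in the radical of `p`" between primary elements is symmetric. This is
what forces the radicals of primary elements to be minimal primes in a weakly factorial monoid. -/
theorem IsPrimaryElement.mem_radicalSet_symm {p q : M} (hp : IsPrimaryElement p)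
    (hq : IsPrimaryElement q) (h : q ∈ radicalSet p) : p ∈ radicalSet q := by
  classical
  have hex : ∃ n : ℕ, p ∣ q ^ n := h
  have hmin : ∀ m < Nat.find hex, ¬ p ∣ q ^ m := fun m hm => Nat.find_min hex hm
  have hspec := Nat.find_spec hex
  generalize Nat.find hex = n at hmin hspec
  obtain _ | k := n
  · exact absurd (isUnit_of_dvd_one (by simpa using hspec)) hp.1
  · obtain ⟨c, hc⟩ := hspec
    have hqc : ¬ q ∣ c := by
      rintro ⟨d, rfl⟩
      refine hmin k (Nat.lt_succ_self k) ⟨d, ?_⟩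
      have : q * q ^ k = q * (p * d) := by rw [← pow_succ', hc, mul_left_comm]
      exact mul_left_cancel this
    obtain ⟨m, -, hm⟩ := hq.2 c p ⟨q ^ k, by rw [mul_comm c p, ← hc, pow_succ']⟩ hqc
    exact ⟨m, hm⟩

theorem IsPrimaryElement.radicalSet_eq {p q : M} (hp : IsPrimaryElement p)
    (hq : IsPrimaryElement q) (h : q ∈ radicalSet p) : radicalSet q = radicalSet p :=
  (radicalSet_subset_of_mem h).antisymm (radicalSet_subset_of_mem (hp.mem_radicalSet_symm hq h))

/-- The elements `a` whose divisibility is not affected by localizing at `S`. If `S` is the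
complement of a minimal prime `P` of a weakly factorial monoid, these are the units together with
the primary elements in `P`. -/
def primaryComponent (S : Submonoid M) : Submonoid M where
  carrier := {a | ∀ b, ∀ c ∈ S, a ∣ b * c → a ∣ b}
  one_mem' := fun b _ _ _ => one_dvd b
  mul_mem' := by
    rintro x y hx hy b c hc h
    obtain ⟨b', rfl⟩ := hx b c hc ((dvd_mul_right x y).trans h)
    obtain ⟨d, hd⟩ := h
    have : y ∣ b' * c := ⟨d, by
      rw [mul_assoc, mul_assoc] at hd
      exact mul_left_cancel hd⟩
    exact mul_dvd_mul_left x (hy b' c hc this)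

theorem mem_primaryComponent_of_mul_mem {S : Submonoid M} {a b : M}
    (h : a * b ∈ primaryComponent S) : a ∈ primaryComponent S := by
  rintro x c hc hx
  have : a * b ∣ x * b * c := by
    rw [mul_right_comm]
    exact mul_dvd_mul_right hx b
  obtain ⟨d, hd⟩ := h _ c hc this
  exact ⟨d, mul_right_cancel (b := b) (by rw [hd, mul_right_comm])⟩

theorem mem_primaryComponent_of_dvd {S : Submonoid M} {a b : M}
    (hb : b ∈ primaryComponent S) (h : a ∣ b) : a ∈ primaryComponent S := by
  obtain ⟨c, rfl⟩ := h
  exact mem_primaryComponent_of_mul_mem hb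

theorem isUnit_of_mem_primaryComponent {S : Submonoid M} {a : M} (ha : a ∈ primaryComponent S)
    (haS : a ∈ S) : IsUnit a :=
  isUnit_of_dvd_one (ha 1 a haS (by simp))

/-- `S` is the complement of the radical of each primary element outside of `S`. If `S` is the
complement of a prime of a weakly factorial monoid, this says that the prime is minimal among the
non-empty ones, or empty. -/
def IsMinimalPrimeCompl (S : Submonoid M) : Prop :=
  ∀ q, IsPrimaryElement q → q ∉ S → (S : Set M) = (radicalSet q)ᶜ

theorem isMinimalPrimeCompl_radicalCompl {p : M} (hp : IsPrimaryElement p) :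
    IsMinimalPrimeCompl (radicalCompl p hp) := by
  intro q hq hqS
  have hqp : q ∈ radicalSet p := not_not.1 hqS
  rw [hp.radicalSet_eq hq hqp]
  rfl

theorem IsMinimalPrimeCompl.mem_primaryComponent {S : Submonoid M} (hS : IsMinimalPrimeCompl S)
    {q : M} (hq : IsPrimaryElement q) (hqS : q ∉ S) : q ∈ primaryComponent S := by
  intro b c hc hdvd
  by_contra hb
  obtain ⟨n, -, hn⟩ := hq.2 b c hdvd hb
  have : c ∈ (S : Set M) := hc
  rw [hS q hq hqS] at this
  exact this ⟨n, hn⟩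

theorem self_mem_primaryComponent {p : M} (hp : IsPrimaryElement p) :
    p ∈ primaryComponent (radicalCompl p hp) :=
  (isMinimalPrimeCompl_radicalCompl hp).mem_primaryComponent hp
    fun h => h (self_mem_radicalSet p)

theorem IsWeaklyFactorial.exists_eq_mul (hwf : IsWeaklyFactorial M) {S : Submonoid M}
    (hS : IsMinimalPrimeCompl S) (a : M) :
    ∃ d ∈ primaryComponent S, ∃ s ∈ S, a = d * s := by
  classical
  by_cases ha : IsUnit a
  · exact ⟨a, fun b _ _ _ => ha.dvd, 1, S.one_mem, (mul_one a).symm⟩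
  · obtain ⟨m, hm, rfl⟩ := hwf a ha
    refine ⟨(m.filter (· ∉ S)).prod, Submonoid.multiset_prod_mem _ _ fun q hq => ?_,
      (m.filter (· ∈ S)).prod, Submonoid.multiset_prod_mem _ _ fun q hq => ?_, ?_⟩
    · rw [Multiset.mem_filter] at hq
      exact hS.mem_primaryComponent (hm q hq.1) hq.2
    · exact (Multiset.mem_filter.1 hq).2
    · rw [mul_comm, ← Multiset.prod_add, Multiset.filter_add_not]

/-- The component of a minimal prime is a primary monoid: every element divides a power of any
given non-unit. -/
theorem IsWeaklyFactorial.exists_dvd_pow (hwf : IsWeaklyFactorial M) {S : Submonoid M}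
    (hS : IsMinimalPrimeCompl S) {a b : M} (ha : a ∈ primaryComponent S)
    (hb : b ∈ primaryComponent S) (hbu : ¬ IsUnit b) : ∃ n : ℕ, a ∣ b ^ n := by
  by_cases hau : IsUnit a
  · exact ⟨0, hau.dvd⟩
  obtain ⟨m, hm, rfl⟩ := hwf a hau
  have hbS : b ∉ S := fun h => hbu (isUnit_of_mem_primaryComponent hb h)
  have key : ∀ q ∈ m, ∃ n : ℕ, q ∣ b ^ n := by
    intro q hq
    have hqS : q ∉ S := fun h => (hm q hq).1 (isUnit_of_mem_primaryComponent
      (mem_primaryComponent_of_dvd ha (Multiset.dvd_prod hq)) h)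
    have h : b ∉ (S : Set M) := hbS
    rw [hS q (hm q hq) hqS] at h
    exact not_not.1 h
  refine Multiset.prod_induction (fun x => ∃ n : ℕ, x ∣ b ^ n) m ?_ ⟨0, one_dvd _⟩ key
  rintro x y ⟨k, hk⟩ ⟨l, hl⟩
  exact ⟨k + l, by rw [pow_add]; exact mul_dvd_mul hk hl⟩

/-- Lengths may be compared prime by prime. -/
theorem HasUniqueLengths.of_primaryComponent (hprim : ∀ u : M, Irreducible u → IsPrimaryElement u)
    (h : ∀ (u : M) (hu : Irreducible u),
      HasUniqueLengths (primaryComponent (radicalCompl u (hprim u hu)))) :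
    HasUniqueLengths (⊤ : Submonoid M) := by
  classical
  intro s
  induction hn : s.card using Nat.strong_induction_on generalizing s with
  | _ n ih =>
    subst hn
    intro t hs ht hst
    rcases s.empty_or_exists_mem with rfl | ⟨u, hu⟩
    · rw [Multiset.eq_zero_of_isUnit_prod (fun v hv => (ht v hv).1)
        (hst.isUnit_iff.1 (by simp))]
    · have hup := hprim u (hs u hu).1
      set S := radicalCompl u hup with hSdef
      have hS : IsMinimalPrimeCompl S := isMinimalPrimeCompl_radicalCompl hup
      -- split both factorizations into the atoms outside `S` and the atoms in `S`
      have split : ∀ r : Multiset M, (r.filter (· ∉ S)).prod * (r.filter (· ∈ S)).prod = r.prod :=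
        fun r => by rw [mul_comm, ← Multiset.prod_add, Multiset.filter_add_not]
      have hcard : ∀ r : Multiset M,
          (r.filter (· ∉ S)).card + (r.filter (· ∈ S)).card = r.card :=
        fun r => by rw [add_comm, ← Multiset.card_add, Multiset.filter_add_not]
      have mem_comp : ∀ r : Multiset M, (∀ v ∈ r, Irreducible v ∧ v ∈ (⊤ : Submonoid M)) →
          ∀ v ∈ r.filter (· ∉ S), Irreducible v ∧ v ∈ primaryComponent S := by
        intro r hr v hv
        rw [Multiset.mem_filter] at hv
        have hv' := (hr v hv.1).1
        exact ⟨hv', hS.mem_primaryComponent (hprim v hv') hv.2⟩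
      have mem_S : ∀ r : Multiset M, (r.filter (· ∈ S)).prod ∈ S := fun r =>
        Submonoid.multiset_prod_mem _ _ fun v hv => (Multiset.mem_filter.1 hv).2
      have dvd_of : ∀ r r' : Multiset M, (∀ v ∈ r, Irreducible v ∧ v ∈ (⊤ : Submonoid M)) →
          r.prod ∣ r'.prod → (r.filter (· ∉ S)).prod ∣ (r'.filter (· ∉ S)).prod := by
        intro r r' hr hrr'
        have hmem : (r.filter (· ∉ S)).prod ∈ primaryComponent S :=
          Submonoid.multiset_prod_mem _ _ fun v hv => (mem_comp r hr v hv).2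
        refine hmem _ _ (mem_S r') ?_
        rw [split r']
        exact (Dvd.intro _ (split r)).trans hrr'
      have h1 : Associated (s.filter (· ∉ S)).prod (t.filter (· ∉ S)).prod :=
        associated_of_dvd_dvd_of_isCancelMul (dvd_of s t hs hst.dvd) (dvd_of t s ht hst.symm.dvd)
      have h2 : Associated (s.filter (· ∈ S)).prod (t.filter (· ∈ S)).prod := by
        obtain ⟨ε, hε⟩ := h1
        obtain ⟨η, hη⟩ := hst
        refine ⟨ε⁻¹ * η, ?_⟩
        rw [← split s, ← split t, ← hε] at hη
        apply mul_left_cancel (a := (s.filter (· ∉ S)).prod * ε)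
        rw [← hη]
        push_cast
        calc _ = (s.filter (· ∉ S)).prod * (s.filter (· ∈ S)).prod * η * (ε * ↑ε⁻¹) := by
              ac_rfl
          _ = _ := by rw [Units.mul_inv, mul_one]
      have e1 := h u (hs u hu).1 _ _ (mem_comp s hs) (mem_comp t ht) h1
      have hlt : (s.filter (· ∈ S)).card < s.card := by
        refine Multiset.card_lt_card (lt_of_le_of_ne (Multiset.filter_le _ _) fun heq => ?_)
        rw [Multiset.filter_eq_self] at heq
        exact heq u hu (self_mem_radicalSet u)
      have e2 := ih _ hlt _ rfl (t.filter (· ∈ S))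
        (fun v hv => hs v (Multiset.mem_filter.1 hv).1)
        (fun v hv => ht v (Multiset.mem_filter.1 hv).1) h2
      rw [← hcard s, ← hcard t, e1, e2]

end Primary

/-! ### Krull monoids -/

section Krull

variable {K : Type*} [CommGroup K]

instance Submonoid.isCancelMul_coe (H : Submonoid K) : IsCancelMul H where
  mul_left_cancel _ _ _ h := Subtype.ext (mul_left_cancel (congrArg Subtype.val h))
  mul_right_cancel _ _ _ h := Subtype.ext (mul_right_cancel (congrArg Subtype.val h))

/-- The group of units of `H`, as a subgroup of `K`. -/
def unitSubgroup (H : Submonoid K) : Subgroup K where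
  carrier := {x | x ∈ H ∧ x⁻¹ ∈ H}
  one_mem' := by simp
  mul_mem' := by
    rintro x y ⟨hx, hx'⟩ ⟨hy, hy'⟩
    exact ⟨H.mul_mem hx hy, by rw [mul_inv]; exact H.mul_mem hx' hy'⟩
  inv_mem' := by
    rintro x ⟨hx, hx'⟩
    exact ⟨hx', by rwa [inv_inv]⟩

theorem mem_unitSubgroup {H : Submonoid K} {x : K} :
    x ∈ unitSubgroup H ↔ x ∈ H ∧ x⁻¹ ∈ H := Iff.rfl

theorem isUnit_coe_iff {H : Submonoid K} (x : H) : IsUnit x ↔ (x : K)⁻¹ ∈ H := by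
  constructor
  · rintro ⟨ε, rfl⟩
    have : ((ε : H) : K)⁻¹ = ((ε⁻¹ : Hˣ) : H) := by
      rw [inv_eq_iff_mul_eq_one, ← Submonoid.coe_mul, Units.mul_inv, Submonoid.coe_one]
    rw [this]
    exact Subtype.coe_prop _
  · intro h
    exact IsUnit.of_mul_eq_one ⟨_, h⟩ (Subtype.ext (by simp))

theorem isUnit_coe_iff_mem_unitSubgroup {H : Submonoid K} (x : H) :
    IsUnit x ↔ (x : K) ∈ unitSubgroup H := by
  rw [isUnit_coe_iff, mem_unitSubgroup]
  exact ⟨fun h => ⟨x.2, h⟩, fun h => h.2⟩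

theorem dvd_coe_iff {H : Submonoid K} (x y : H) : x ∣ y ↔ (y : K) * (x : K)⁻¹ ∈ H := by
  constructor
  · rintro ⟨c, rfl⟩
    simp
  · intro h
    exact ⟨⟨_, h⟩, Subtype.ext (by simp)⟩

theorem mem_unitSet_iff {H : Submonoid K} {x : K} : x ∈ unitSet H ↔ x ∈ unitSubgroup H := by
  constructor
  · rintro ⟨u, hu, rfl⟩
    exact (isUnit_coe_iff_mem_unitSubgroup u).1 hu
  · intro h
    exact ⟨⟨x, h.1⟩, (isUnit_coe_iff_mem_unitSubgroup _).2 h, rfl⟩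

theorem mem_atomSet_iff {H : Submonoid K} {x : K} :
    x ∈ atomSet H ↔ x ∈ H ∧ x⁻¹ ∉ H ∧ ∀ a ∈ H, ∀ b ∈ H, x = a * b → a⁻¹ ∈ H ∨ b⁻¹ ∈ H := by
  constructor
  · rintro ⟨u, hu, rfl⟩
    refine ⟨u.2, fun h => hu.not_isUnit ((isUnit_coe_iff u).2 h), fun a ha b hb hab => ?_⟩
    have := hu.isUnit_or_isUnit (a := ⟨a, ha⟩) (b := ⟨b, hb⟩) (Subtype.ext hab)
    rwa [isUnit_coe_iff, isUnit_coe_iff] at this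
  · rintro ⟨hx, hxu, hirr⟩
    refine ⟨⟨x, hx⟩, ⟨fun h => hxu ((isUnit_coe_iff _).1 h), fun a b hab => ?_⟩, rfl⟩
    rw [isUnit_coe_iff, isUnit_coe_iff]
    exact hirr a a.2 b b.2 (congrArg Subtype.val hab)

theorem coe_mem_atomSet_iff {H : Submonoid K} {u : H} : (u : K) ∈ atomSet H ↔ Irreducible u :=
  ⟨fun ⟨_, hv, h⟩ => Subtype.ext h ▸ hv, fun h => ⟨u, h, rfl⟩⟩

theorem mul_mem_atomSet {H : Submonoid K} {u ε : K} (hu : u ∈ atomSet H)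
    (hε : ε ∈ unitSubgroup H) : u * ε ∈ atomSet H := by
  obtain ⟨hu, hu', hirr⟩ := mem_atomSet_iff.1 hu
  refine mem_atomSet_iff.2 ⟨H.mul_mem hu hε.1, fun h => hu' ?_, fun a ha b hb hab => ?_⟩
  · have : u⁻¹ = (u * ε)⁻¹ * ε := by rw [mul_inv, inv_mul_cancel_right]
    rw [this]
    exact H.mul_mem h hε.1
  · have hub : u = a * (b * ε⁻¹) := by rw [← mul_assoc, ← hab, mul_inv_cancel_right]
    refine (hirr a ha _ (H.mul_mem hb hε.2) hub).imp_right fun h => ?_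
    have : b⁻¹ = (b * ε⁻¹)⁻¹ * ε⁻¹ := by rw [mul_inv, inv_mul_cancel_right]
    rw [this]
    exact H.mul_mem h hε.2

theorem isTIdeal_vClosure {B : Submonoid K} {A : Set K} (hA : A ⊆ B) :
    IsTIdeal B (vClosure B A) := by
  refine ⟨fun x hx => ?_, Set.Subset.antisymm ?_ fun x hx => ?_⟩
  · simpa using hx 1 fun a ha => by simpa using hA ha
  · rintro x ⟨E, hE, -, hx⟩ w hw
    refine hx w fun e he => ?_
    rw [mul_comm]
    exact hE he w hw
  · exact ⟨{x}, by simpa using hx, Set.finite_singleton x, fun w hw => by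
      simpa [mul_comm] using hw x rfl⟩

/-- Principal ideals satisfy the ascending chain condition in a Mori monoid. -/
theorem IsMori.exists_mem_unitSubgroup {B : Submonoid K} (hB : IsMori B) (f : ℕ → K)
    (hf : ∀ n, f n ∈ B) (h : ∀ n, f n * (f (n + 1))⁻¹ ∈ B) :
    ∃ n, f n * (f (n + 1))⁻¹ ∈ unitSubgroup B := by
  have hle : ∀ n, vClosure B {f n} ⊆ vClosure B {f (n + 1)} := by
    intro n x hx w hw
    refine hx w fun b hb => ?_
    rw [Set.mem_singleton_iff.1 hb]
    have := B.mul_mem (hw _ rfl) (h n)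
    rwa [mul_assoc, mul_mul_inv_cancel'_right] at this
  obtain ⟨N, hN⟩ := hB (fun n => vClosure B {f n})
    (fun n => isTIdeal_vClosure (by simpa using hf n)) hle
  refine ⟨N, h N, ?_⟩
  have hmem : f (N + 1) ∈ vClosure B {f (N + 1)} := fun w hw => by
    simpa [mul_comm] using hw _ rfl
  have hmem' : f (N + 1) ∈ vClosure B {f N} := by
    have := hN (N + 1) (Nat.le_succ N)
    rwa [← this]
  have := hmem' (f N)⁻¹ fun b hb => by simp [Set.mem_singleton_iff.1 hb]
  rwa [mul_inv, inv_inv, mul_comm]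

theorem pow_eq_of_mul_inv_mem {B : Submonoid K} {p : K} (hp : p ∈ B) (hp' : p⁻¹ ∉ B) {k l : ℕ}
    (h : p ^ k * (p ^ l)⁻¹ ∈ unitSubgroup B) : k = l := by
  have aux : ∀ {k l : ℕ}, p ^ k * (p ^ l)⁻¹ ∈ B → l ≤ k := by
    intro k l h
    by_contra! hlt
    obtain ⟨d, rfl⟩ := Nat.exists_eq_add_of_lt hlt
    apply hp'
    have : p⁻¹ = p ^ k * (p ^ (k + d + 1))⁻¹ * p ^ d := by
      rw [pow_succ, pow_add]; group
    rw [this]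
    exact B.mul_mem h (B.pow_mem hp d)
  refine le_antisymm (aux ?_) (aux h.1)
  have := h.2
  rwa [mul_inv, inv_inv, mul_comm] at this

/-- A primary divisor-closed submonoid `C` of a Krull monoid `B` that is not a group is, up to
units, generated by one element. Among the sets `{x ∈ C | x z ∈ B}` with `z` in the quotient group
of `C` but not in `B` there is a maximal one; maximality and primariness show that it consists of
all non-units of `C`. As `B` is completely integrally closed, some product `z p` is a unit. -/
theorem IsKrull.exists_uniformizer {B : Submonoid K} (hB : IsKrull B) {C : Submonoid K}
    (hCB : C ≤ B) (hdc : ∀ x ∈ B, ∀ y ∈ B, x * y ∈ C → x ∈ C)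
    (hprim : ∀ x ∈ C, ∀ y ∈ C, y⁻¹ ∉ B → ∃ n : ℕ, y ^ n * x⁻¹ ∈ B)
    (hne : ∃ y ∈ C, y⁻¹ ∉ B) :
    ∃ p ∈ C, p⁻¹ ∉ B ∧ ∀ c ∈ C, ∃ n : ℕ, c * (p ^ n)⁻¹ ∈ unitSubgroup B := by
  let Z : Set K := {z | z ∉ B ∧ ∃ c ∈ C, ∃ d ∈ C, z = c * d⁻¹}
  let E : K → Set K := fun z => {x | x ∈ C ∧ x * z ∈ B}
  have hEB : ∀ z, E z ⊆ B := fun z x hx => hCB hx.1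
  have hmax : ∃ z ∈ Z, ∀ z' ∈ Z, E z ⊆ E z' → E z' ⊆ E z := by
    by_contra! hcon
    choose! g hgZ hg hg' using hcon
    obtain ⟨y, hyC, hyB⟩ := hne
    have hy : y⁻¹ ∈ Z := ⟨hyB, 1, C.one_mem, y, hyC, by simp⟩
    let f : ℕ → K := fun n => g^[n] y⁻¹
    have hf : ∀ n, f n ∈ Z := by
      intro n
      induction n with
      | zero => exact hy
      | succ n ih =>
        simp only [f, Function.iterate_succ_apply']
        exact hgZ _ ih
    have hfs : ∀ n, f (n + 1) = g (f n) := fun n => Function.iterate_succ_apply' g n _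
    obtain ⟨N, hN⟩ := hB.2 (fun n => vClosure B (E (f n))) (fun n => isTIdeal_vClosure (hEB _))
      (fun n x hx w hw => hx w fun b hb => hw b (by rw [hfs]; exact hg _ (hf n) hb))
    refine hg' _ (hf N) fun x hx => ⟨hx.1, ?_⟩
    have hmem : x ∈ vClosure B (E (f (N + 1))) := fun w hw => by
      rw [mul_comm]
      exact hw x (by rwa [hfs])
    have heq := hN (N + 1) (Nat.le_succ N)
    rw [heq] at hmem
    exact hmem _ fun b hb => by
      rw [mul_comm]
      exact hb.2
  obtain ⟨z, ⟨hzB, c, hc, d, hd, hz⟩, hzmax⟩ := hmax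
  have hdE : d ∈ E z := ⟨hd, by rw [hz, mul_comm, inv_mul_cancel_right]; exact hCB hc⟩
  -- every non-unit of `C` multiplies `z` into `B`
  have hall : ∀ y ∈ C, y⁻¹ ∉ B → y * z ∈ B := by
    classical
    intro y hyC hyB
    have hex : ∃ n : ℕ, y ^ n * z ∈ B := by
      obtain ⟨n, hn⟩ := hprim d hd y hyC hyB
      refine ⟨n, ?_⟩
      have : y ^ n * z = y ^ n * d⁻¹ * c := by rw [hz]; ac_rfl
      rw [this]
      exact B.mul_mem hn (hCB hc)
    have hspec := Nat.find_spec hex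
    have hmin : ∀ m < Nat.find hex, y ^ m * z ∉ B := fun m hm => Nat.find_min hex hm
    generalize Nat.find hex = n at hspec hmin
    obtain _ | k := n
    · exact absurd (by simpa using hspec) hzB
    have hz' : y ^ k * z ∈ Z := ⟨hmin k (Nat.lt_succ_self k), y ^ k * c,
      C.mul_mem (C.pow_mem hyC k) hc, d, hd, by rw [hz, mul_assoc]⟩
    have hsub : E z ⊆ E (y ^ k * z) := fun x hx => ⟨hx.1, by
      rw [mul_left_comm]
      exact B.mul_mem (B.pow_mem (hCB hyC) k) hx.2⟩
    exact (hzmax _ hz' hsub ⟨hyC, by rwa [← mul_assoc, ← pow_succ']⟩).2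
  -- a product `y z ∈ B` with `y ∈ C` lies in `C`
  have hzC : ∀ y ∈ C, y * z ∈ B → y * z ∈ C := fun y hy hyz =>
    hdc _ hyz d (hCB hd) (by
      rw [hz, mul_assoc, inv_mul_cancel_right]
      exact C.mul_mem hy hc)
  obtain ⟨p, hpC, hpB, hpz⟩ : ∃ p ∈ C, p⁻¹ ∉ B ∧ (p * z)⁻¹ ∈ B := by
    by_contra! hcon
    obtain ⟨y, hyC, hyB⟩ := hne
    have hpow : ∀ n : ℕ, y * z ^ n ∈ C ∧ (y * z ^ n)⁻¹ ∉ B := by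
      intro n
      induction n with
      | zero => simpa using ⟨hyC, hyB⟩
      | succ n ih =>
        rw [pow_succ, ← mul_assoc]
        exact ⟨hzC _ ih.1 (hall _ ih.1 ih.2), hcon _ ih.1 ih.2⟩
    apply hzB
    have : z ∈ completeIntClosure B := ⟨y, hCB hyC, fun n _ => hCB (hpow n).1⟩
    rw [← hB.1] at this
    exact this
  refine ⟨p, hpC, hpB, fun c' hc' => ?_⟩
  -- dividing by `p` stays inside `C` until a unit is reached
  have hdiv : ∀ y ∈ C, y⁻¹ ∉ B → y * p⁻¹ ∈ C := by
    intro y hyC hyB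
    have h1 : y * p⁻¹ ∈ B := by
      have : y * p⁻¹ = y * z * (p * z)⁻¹ := by group
      rw [this]
      exact B.mul_mem (hall y hyC hyB) hpz
    exact hdc _ h1 p (hCB hpC) (by simpa using hyC)
  by_contra! hcon
  have hpow : ∀ n : ℕ, c' * (p ^ n)⁻¹ ∈ C := by
    intro n
    induction n with
    | zero => simpa using hc'
    | succ n ih =>
      have hnu : (c' * (p ^ n)⁻¹)⁻¹ ∉ B := fun h => hcon n ⟨hCB ih, h⟩
      have := hdiv _ ih hnu
      rwa [mul_assoc, ← mul_inv, ← pow_succ] at this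
  apply hpB
  have : p⁻¹ ∈ completeIntClosure B := ⟨c', hCB hc', fun n _ => by
    rw [inv_pow]
    exact hCB (hpow n)⟩
  rw [← hB.1] at this
  exact this

/-- An atom that is a unit times a power of a non-unit is associated to that non-unit. -/
theorem mul_inv_mem_unitSubgroup_of_mem_atomSet {B : Submonoid K} {v p : K} (hv : v ∈ atomSet B)
    (hp : p ∈ B) (hp' : p⁻¹ ∉ B) {n : ℕ} (h : v * (p ^ n)⁻¹ ∈ unitSubgroup B) :
    v * p⁻¹ ∈ unitSubgroup B := by
  obtain ⟨-, hvu, hirr⟩ := mem_atomSet_iff.1 hv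
  obtain _ | n := n
  · exact absurd (by simpa using h.2) hvu
  have hmem : v * p⁻¹ ∈ B := by
    have : v * p⁻¹ = v * (p ^ (n + 1))⁻¹ * p ^ n := by rw [pow_succ]; group
    rw [this]
    exact B.mul_mem h.1 (B.pow_mem hp n)
  exact ⟨hmem, (hirr p hp _ hmem (by rw [mul_comm, inv_mul_cancel_right])).resolve_left hp'⟩

/-- If a homomorphism to a group sends all atoms in `D` to associates of a single non-unit,
then lengths in `D` are unique. -/
theorem HasUniqueLengths.of_monoidHom {M : Type*} [CommMonoid M] {D : Submonoid M} (f : M →* K)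
    {B : Submonoid K} {p : K} (hp : p ∈ B) (hp' : p⁻¹ ∉ B)
    (hunit : ∀ ε : M, IsUnit ε → f ε ∈ unitSubgroup B)
    (h : ∀ u ∈ D, Irreducible u → f u * p⁻¹ ∈ unitSubgroup B) : HasUniqueLengths D := by
  have key : ∀ s : Multiset M, (∀ u ∈ s, Irreducible u ∧ u ∈ D) →
      f s.prod * (p ^ s.card)⁻¹ ∈ unitSubgroup B := by
    intro s
    induction s using Multiset.induction_on with
    | empty => simp
    | cons u s ih =>
      intro hs
      rw [Multiset.prod_cons, Multiset.card_cons, map_mul, pow_succ']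
      have := mul_mem (h u (hs u (Multiset.mem_cons_self u s)).2
        (hs u (Multiset.mem_cons_self u s)).1) (ih fun v hv => hs v (Multiset.mem_cons_of_mem hv))
      rwa [mul_mul_mul_comm, ← mul_inv] at this
  rintro s t hs ht ⟨ε, hε⟩
  refine pow_eq_of_mul_inv_mem hp hp' ?_
  have h1 := key s hs
  have h2 := key t ht
  have h3 := hunit ε ε.isUnit
  rw [← hε, map_mul] at h2
  have : p ^ s.card * (p ^ t.card)⁻¹ = (f s.prod * (p ^ s.card)⁻¹)⁻¹ *
      (f s.prod * f ε * (p ^ t.card)⁻¹) * (f ε)⁻¹ := by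
    rw [mul_inv, inv_inv]
    calc _ = p ^ s.card * (p ^ t.card)⁻¹ * ((f s.prod)⁻¹ * f s.prod) * (f ε * (f ε)⁻¹) := by simp
      _ = _ := by ac_rfl
  rw [this]
  exact mul_mem (mul_mem (inv_mem h1) h2) (inv_mem h3)

end Krull

/-! ### Transfer homomorphisms to Krull monoids -/

section Transfer

variable {M : Type*} [CommMonoid M]

theorem IsTransferHom.irreducible {B : Type*} [CommMonoid B] {θ : M →* B} (hθ : IsTransferHom θ)
    {u : M} (hu : Irreducible u) : Irreducible (θ u) := by
  refine ⟨fun h => hu.not_isUnit ((hθ.isUnit_iff u).1 h), fun b c hbc => ?_⟩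
  obtain ⟨v, w, ε, η, hvw, hv, hw⟩ := hθ.lift u b c hbc
  refine (hu.isUnit_or_isUnit hvw).imp (fun h => ?_) fun h => ?_
  · rw [← hθ.isUnit_iff, hv] at h
    simpa using h
  · rw [← hθ.isUnit_iff, hw] at h
    simpa using h

/-- A primary divisor-closed submonoid `D` of a transfer Krull monoid has unique lengths: the
image of `D` generates a primary divisor-closed submonoid of a Krull monoid, which has only one
atom up to units. -/
theorem IsTransferKrull.hasUniqueLengths (hM : IsTransferKrull M) {D : Submonoid M}
    (hdc : ∀ a b, a * b ∈ D → a ∈ D)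
    (hprim : ∀ a ∈ D, ∀ b ∈ D, ¬ IsUnit b → ∃ n : ℕ, a ∣ b ^ n) : HasUniqueLengths D := by
  obtain ⟨L, _, B, -, hB, θ, hθ⟩ := hM
  let C : Submonoid L :=
    { carrier := {x | ∃ a ∈ D, ∃ ε : Bˣ, x = ((θ a * ε : B) : L)}
      one_mem' := ⟨1, D.one_mem, 1, by simp⟩
      mul_mem' := by
        rintro x y ⟨a, ha, ε, rfl⟩ ⟨b, hb, η, rfl⟩
        refine ⟨a * b, D.mul_mem ha hb, ε * η, ?_⟩
        rw [map_mul, Units.val_mul, ← Submonoid.coe_mul, mul_mul_mul_comm] }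
  have hθC : ∀ a ∈ D, (θ a : L) ∈ C := fun a ha => ⟨a, ha, 1, by simp⟩
  by_cases hne : ∃ u ∈ D, Irreducible u
  swap
  · intro s t hs ht _
    rw [Multiset.eq_zero_of_forall_notMem (s := s) fun u hu => hne ⟨u, (hs u hu).2, (hs u hu).1⟩,
      Multiset.eq_zero_of_forall_notMem (s := t) fun u hu => hne ⟨u, (ht u hu).2, (ht u hu).1⟩]
  obtain ⟨p, hpC, hp', hp⟩ := hB.exists_uniformizer (C := C)
    (by rintro x ⟨a, -, ε, rfl⟩; exact Subtype.coe_prop _)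
    (by
      rintro x hx y hy ⟨a, ha, ε, hxy⟩
      have hxy' : θ a = ⟨x, hx⟩ * (⟨y, hy⟩ * ((ε⁻¹ : Bˣ) : B)) := by
        rw [← mul_assoc, ← Units.mul_inv_eq_iff_eq_mul, inv_inv]
        exact Subtype.ext hxy.symm
      obtain ⟨v, w, ε', η, rfl, hv, -⟩ := hθ.lift a _ _ hxy'
      refine ⟨v, hdc v w ha, ε'⁻¹, ?_⟩
      rw [hv, Units.mul_inv_cancel_right])
    (by
      rintro x ⟨a, ha, ε, rfl⟩ y ⟨b, hb, η, rfl⟩ hy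
      rw [← isUnit_coe_iff, Units.isUnit_mul_units, hθ.isUnit_iff] at hy
      obtain ⟨n, hn⟩ := hprim a ha b hb hy
      refine ⟨n, ?_⟩
      rw [← SubmonoidClass.coe_pow, ← dvd_coe_iff, Units.mul_right_dvd, mul_pow, ← map_pow]
      exact (map_dvd θ hn).mul_right _)
    (by
      obtain ⟨u, huD, hu⟩ := hne
      refine ⟨_, hθC u huD, ?_⟩
      rw [← isUnit_coe_iff, hθ.isUnit_iff]
      exact hu.not_isUnit)
  have hpB : p ∈ B := by
    obtain ⟨a, -, ε, rfl⟩ := hpC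
    exact Subtype.coe_prop _
  refine HasUniqueLengths.of_monoidHom (B.subtype.comp θ) hpB hp' (fun ε hε => ?_)
    fun u huD hu => ?_
  · exact (isUnit_coe_iff_mem_unitSubgroup _).1 ((hθ.isUnit_iff ε).2 hε)
  · obtain ⟨n, hn⟩ := hp _ (hθC u huD)
    exact mul_inv_mem_unitSubgroup_of_mem_atomSet (coe_mem_atomSet_iff.2 (hθ.irreducible hu))
      hpB hp' hn

/-- The nonnegative integers as a submonoid of the (multiplicatively written) integers. -/
def natSubmonoid.{u} : Submonoid (ULift.{u} (Multiplicative ℤ)) where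
  carrier := {x | 0 ≤ x.down.toAdd}
  one_mem' := le_refl (0 : ℤ)
  mul_mem' := fun {_ _} hx hy => add_nonneg (α := ℤ) hx hy

theorem mem_natSubmonoid.{u} {x : ULift.{u} (Multiplicative ℤ)} :
    x ∈ natSubmonoid ↔ 0 ≤ x.down.toAdd := Iff.rfl

theorem isQuotientGroupOf_natSubmonoid : IsQuotientGroupOf natSubmonoid := by
  intro x
  refine ⟨⟨.ofAdd (max x.down.toAdd 0)⟩, mem_natSubmonoid.2 (le_max_right _ _),
    ⟨.ofAdd (max (-x.down.toAdd) 0)⟩, mem_natSubmonoid.2 (le_max_right _ _), ?_⟩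
  apply ULift.ext
  apply Multiplicative.toAdd.injective
  change x.down.toAdd = max x.down.toAdd 0 + -max (-x.down.toAdd) 0
  omega

theorem isKrull_natSubmonoid : IsKrull natSubmonoid := by
  constructor
  · ext x
    constructor
    · intro hx
      exact ⟨1, one_mem _, fun n _ => by rw [one_mul]; exact pow_mem hx n⟩
    · rintro ⟨c, -, h⟩
      by_contra hx
      have hx' : x.down.toAdd < 0 := not_le.1 hx
      have hn := h (c.down.toAdd.toNat + 1) (Nat.succ_pos _)
      rw [mem_natSubmonoid] at hn
      change 0 ≤ c.down.toAdd + (c.down.toAdd.toNat + 1) • x.down.toAdd at hn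
      rw [nsmul_eq_mul] at hn
      have := Int.self_le_toNat c.down.toAdd
      push_cast at hn
      nlinarith
  · intro A hA hmono
    -- `t`-ideals are upwards closed, so a chain is stationary once its least element is reached
    have hup : ∀ n, ∀ x ∈ A n, ∀ y, x.down.toAdd ≤ y.down.toAdd → y ∈ A n := by
      intro n x hx y hxy
      rw [← (hA n).2]
      refine ⟨{x}, by simpa using hx, Set.finite_singleton x, fun w hw => ?_⟩
      have h1 := hw x rfl
      change 0 ≤ w.down.toAdd + x.down.toAdd at h1
      change 0 ≤ y.down.toAdd + w.down.toAdd
      omega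
    have hmono' : Monotone A := monotone_nat_of_le_succ hmono
    by_cases hne : ∃ k : ℕ, ∃ n, ∃ x ∈ A n, x.down.toAdd = (k : ℤ)
    · classical
      obtain ⟨N, x, hx, hxk⟩ := Nat.find_spec hne
      refine ⟨N, fun n hn => (hmono' hn).antisymm' fun y hy => hup N x hx y ?_⟩
      have hy0 : 0 ≤ y.down.toAdd := (hA n).1 hy
      obtain ⟨l, hl⟩ := Int.eq_ofNat_of_zero_le hy0
      have := Nat.find_min' hne ⟨n, y, hy, hl⟩
      omega
    · have hempty : ∀ n, A n = ∅ := by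
        intro n
        refine Set.eq_empty_of_forall_notMem fun y hy => hne ?_
        have hy0 : 0 ≤ y.down.toAdd := (hA n).1 hy
        obtain ⟨l, hl⟩ := Int.eq_ofNat_of_zero_le hy0
        exact ⟨l, n, y, hy, hl⟩
      exact ⟨0, fun n _ => by rw [hempty, hempty]⟩

/-- A half-factorial monoid that is not a group has a transfer homomorphism to the nonnegative
integers, given by the length. A group has one to the trivial group. -/
theorem IsHalfFactorial.isTransferKrull (hM : IsHalfFactorial M) : IsTransferKrull M := by
  rw [isHalfFactorial_iff] at hM
  obtain ⟨hat, huniq⟩ := hM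
  by_cases hne : ∃ u : M, Irreducible u
  swap
  · have hunit : ∀ a : M, IsUnit a := by
      intro a
      by_contra ha
      obtain ⟨s, hs, rfl⟩ := hat a ha
      rw [Multiset.eq_zero_of_forall_notMem (s := s) fun u hu => hne ⟨u, hs u hu⟩] at ha
      simp at ha
    refine ⟨PUnit, inferInstance, ⊤, fun x => ⟨1, trivial, 1, trivial, rfl⟩, ⟨?_, ?_⟩, 1, ?_⟩
    · ext x
      exact ⟨fun _ => ⟨1, trivial, fun _ _ => trivial⟩, fun _ => trivial⟩
    · intro A _ hmono
      by_cases h : ∃ N, (1 : PUnit) ∈ A N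
      · obtain ⟨N, hN⟩ := h
        exact ⟨N, fun n hn => Set.ext fun x => ⟨fun _ => hN,
          fun hx => monotone_nat_of_le_succ hmono hn hx⟩⟩
      · push Not at h
        exact ⟨0, fun n _ => Set.ext fun x => ⟨fun hx => absurd hx (h n),
          fun hx => absurd hx (h 0)⟩⟩
    · exact ⟨fun b => ⟨1, 1, rfl⟩, fun a => ⟨fun _ => hunit a, fun _ => isUnit_one⟩,
        fun u b c _ => ⟨u, 1, 1, 1, by simp, rfl, rfl⟩⟩
  · have hfac : ∀ a : M, ∃ s : Multiset M, (∀ u ∈ s, Irreducible u) ∧ Associated s.prod a := by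
      intro a
      by_cases ha : IsUnit a
      · exact ⟨0, by simp, by simpa using (associated_one_iff_isUnit.2 ha).symm⟩
      · obtain ⟨s, hs, rfl⟩ := hat a ha
        exact ⟨s, hs, Associated.refl _⟩
    choose fac hfac hfaca using hfac
    have hlen : ∀ (s : Multiset M) (a : M), (∀ u ∈ s, Irreducible u) → Associated s.prod a →
        (fac a).card = s.card := fun s a hs hsa =>
      huniq _ _ (fun u hu => ⟨hfac a u hu, trivial⟩) (fun u hu => ⟨hs u hu, trivial⟩)
        ((hfaca a).trans hsa.symm)
    let θ : M →* natSubmonoid.{u_1} :=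
      { toFun := fun a => ⟨⟨.ofAdd ((fac a).card : ℤ)⟩, Int.natCast_nonneg _⟩
        map_one' := by
          have := hlen 0 1 (by simp) (by simp)
          apply Subtype.ext
          apply ULift.ext
          apply Multiplicative.toAdd.injective
          change ((fac 1).card : ℤ) = 0
          simp [this]
        map_mul' := fun a b => by
          have := hlen (fac a + fac b) (a * b)
            (fun u hu => (Multiset.mem_add.1 hu).elim (hfac a u) (hfac b u))
            (by rw [Multiset.prod_add]; exact (hfaca a).mul_mul (hfaca b))
          apply Subtype.ext
          apply ULift.ext
          apply Multiplicative.toAdd.injective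
          change ((fac (a * b)).card : ℤ) = (fac a).card + (fac b).card
          rw [this, Multiset.card_add]
          push_cast
          rfl }
    have hθ : ∀ a, (θ a : ULift (Multiplicative ℤ)).down.toAdd = ((fac a).card : ℤ) :=
      fun _ => rfl
    have hext : ∀ x y : natSubmonoid.{u_1}, x.1.down.toAdd = y.1.down.toAdd → x = y :=
      fun x y h => Subtype.ext (ULift.ext _ _ (Multiplicative.toAdd.injective h))
    obtain ⟨p, hp⟩ := hne
    refine ⟨_, inferInstance, natSubmonoid, isQuotientGroupOf_natSubmonoid, isKrull_natSubmonoid,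
      θ, ⟨fun b => ?_, fun a => ⟨fun h => ?_, fun h => h.map θ⟩, fun u b c hbc => ?_⟩⟩
    · obtain ⟨k, hk⟩ := Int.eq_ofNat_of_zero_le b.2
      refine ⟨p ^ k, 1, ?_⟩
      rw [Units.val_one, mul_one]
      apply hext
      rw [hθ, hlen (Multiset.replicate k p) (p ^ k)
        (fun u hu => Multiset.eq_of_mem_replicate hu ▸ hp) (by simp)]
      simpa using hk
    · obtain ⟨c, hc⟩ := h.exists_right_inv
      have h1 : (θ a).1.down.toAdd + c.1.down.toAdd = 0 :=
        congrArg (fun x : natSubmonoid.{u_1} => x.1.down.toAdd) hc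
      have h2 : 0 ≤ c.1.down.toAdd := c.2
      rw [hθ] at h1
      have h3 : (fac a).card = 0 := by omega
      have := hfaca a
      rw [Multiset.card_eq_zero.1 h3, Multiset.prod_zero] at this
      exact this.isUnit isUnit_one
    · have h1 : (θ u).1.down.toAdd = b.1.down.toAdd + c.1.down.toAdd :=
        congrArg (fun x : natSubmonoid.{u_1} => x.1.down.toAdd) hbc
      obtain ⟨k, hk⟩ := Int.eq_ofNat_of_zero_le (show 0 ≤ b.1.down.toAdd from b.2)
      obtain ⟨l, hl⟩ := Int.eq_ofNat_of_zero_le (show 0 ≤ c.1.down.toAdd from c.2)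
      rw [hθ, hk, hl] at h1
      -- distribute the atoms of a factorization of `u`
      obtain ⟨s, hs⟩ := Multiset.exists_mem_of_ne_zero (s := Multiset.powersetCard k (fac u)) (by
        rw [← Multiset.card_pos, Multiset.card_powersetCard]
        exact Nat.choose_pos (by omega))
      obtain ⟨hsle, hscard⟩ := Multiset.mem_powersetCard.1 hs
      obtain ⟨t, ht⟩ := Multiset.le_iff_exists_add.1 hsle
      obtain ⟨ε, hε⟩ := hfaca u
      have hmem := hfac u
      rw [ht] at hmem hε h1
      rw [Multiset.prod_add] at hε
      rw [Multiset.card_add] at h1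
      refine ⟨s.prod, t.prod * ε, 1, 1, by rw [← hε, mul_assoc], hext _ _ ?_, hext _ _ ?_⟩
      · rw [hθ, hlen s _ (fun v hv => hmem v (Multiset.mem_add.2 (Or.inl hv))) (Associated.refl _),
          Units.val_one, mul_one, hk, hscard]
      · rw [hθ, hlen t _ (fun v hv => hmem v (Multiset.mem_add.2 (Or.inr hv))) ⟨ε, rfl⟩,
          Units.val_one, mul_one, hl]
        omega

end Transfer

/-! ### The root closure -/

section RootClosure

variable {K : Type*} [CommGroup K] {H : Submonoid K}

/-- The class of an element of the quotient group modulo the units of `B`. -/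
def unitClass (B : Submonoid K) : K →* K ⧸ unitSubgroup B := QuotientGroup.mk' _

theorem unitClass_eq_iff {B : Submonoid K} {x y : K} :
    unitClass B x = unitClass B y ↔ x * y⁻¹ ∈ unitSubgroup B := by
  rw [← QuotientGroup.eq_one_iff, ← mul_inv_eq_one]
  rfl

theorem unitClass_eq_one_iff {B : Submonoid K} {x : K} :
    unitClass B x = 1 ↔ x ∈ unitSubgroup B := QuotientGroup.eq_one_iff x

theorem mem_of_unitClass_eq {B : Submonoid K} {x y : K} (h : unitClass B x = unitClass B y)
    (hy : y ∈ B) : x ∈ B := by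
  have := B.mul_mem (unitClass_eq_iff.1 h).1 hy
  rwa [inv_mul_cancel_right] at this

theorem associated_coe_iff (x y : H) :
    Associated x y ↔ unitClass H (x : K) = unitClass H (y : K) := by
  constructor
  · rintro ⟨ε, rfl⟩
    rw [Submonoid.coe_mul, map_mul,
      unitClass_eq_one_iff.2 ((isUnit_coe_iff_mem_unitSubgroup _).1 ε.isUnit), mul_one]
  · intro h
    exact associated_of_dvd_dvd_of_isCancelMul
      ((dvd_coe_iff _ _).2 (unitClass_eq_iff.1 h.symm).1)
      ((dvd_coe_iff _ _).2 (unitClass_eq_iff.1 h).1)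

theorem le_rootClosure : H ≤ rootClosure H := fun _ hx => ⟨1, one_pos, by simpa using hx⟩

theorem mem_rootClosure_of_pow {x : K} {N : ℕ} (hN : 0 < N) (hx : x ^ N ∈ rootClosure H) :
    x ∈ rootClosure H := by
  obtain ⟨M, hM, h⟩ := hx
  exact ⟨N * M, Nat.mul_pos hN hM, by rwa [pow_mul]⟩

theorem inv_mem_of_inv_mem_rootClosure {x : K} (hx : x ∈ H) (h : x⁻¹ ∈ rootClosure H) :
    x⁻¹ ∈ H := by
  obtain ⟨N, hN, h⟩ := h
  obtain ⟨n, rfl⟩ := Nat.exists_eq_succ_of_ne_zero hN.ne'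
  have : x⁻¹ = x⁻¹ ^ (n + 1) * x ^ n := by rw [pow_succ', inv_pow, inv_mul_cancel_right]
  rw [this]
  exact H.mul_mem h (H.pow_mem hx n)

theorem isUnit_coe_iff_rootClosure (x : H) : IsUnit x ↔ (x : K)⁻¹ ∈ rootClosure H := by
  rw [isUnit_coe_iff]
  exact ⟨fun h => le_rootClosure h, inv_mem_of_inv_mem_rootClosure x.2⟩

theorem exists_pow_mem_unitSubgroup {ε : K} (hε : ε ∈ unitSubgroup (rootClosure H)) :
    ∃ N : ℕ, 0 < N ∧ ε ^ N ∈ unitSubgroup H := by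
  obtain ⟨⟨M, hM, h⟩, ⟨N, hN, h'⟩⟩ := hε
  refine ⟨M * N, Nat.mul_pos hM hN, by rw [pow_mul]; exact H.pow_mem h N, ?_⟩
  rw [mul_comm, pow_mul, ← inv_pow, ← inv_pow]
  exact H.pow_mem h' M

/-- A monoid is atomic if its root closure is Krull: ascending chains of principal ideals stay
proper in the root closure, as no new elements of the monoid become units. -/
theorem IsKrull.isAtomicMonoid_of_rootClosure (hB : IsKrull (rootClosure H)) :
    IsAtomicMonoid H := by
  refine IsAtomicMonoid.of_wellFounded (wellFounded_iff_isEmpty_descending_chain.2 ⟨?_⟩)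
  rintro ⟨f, hf⟩
  choose c hc hfc using hf
  have hfc' : ∀ n, (f n : K) * (f (n + 1) : K)⁻¹ = c n := fun n => by
    rw [hfc n, Submonoid.coe_mul, mul_comm, inv_mul_cancel_left]
  obtain ⟨n, hn⟩ := hB.2.exists_mem_unitSubgroup (fun n => (f n : K))
    (fun n => le_rootClosure (f n).2) fun n => by
      rw [hfc']
      exact le_rootClosure (c n).2
  simp only [hfc'] at hn
  exact hc n ((isUnit_coe_iff_rootClosure _).2 hn.2)

/-- The elements of `K` with a positive power in the primary component of `S`. -/
def rootComponent (S : Submonoid H) : Submonoid K where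
  carrier := {x | ∃ N : ℕ, 0 < N ∧ ∃ d ∈ primaryComponent S, x ^ N = d}
  one_mem' := ⟨1, one_pos, 1, one_mem _, by simp⟩
  mul_mem' := by
    rintro x y ⟨m, hm, d, hd, hx⟩ ⟨n, hn, e, he, hy⟩
    refine ⟨m * n, Nat.mul_pos hm hn, d ^ n * e ^ m, mul_mem (pow_mem hd n) (pow_mem he m), ?_⟩
    rw [mul_pow, pow_mul, hx, mul_comm m n, pow_mul, hy]
    simp

theorem rootComponent_le (S : Submonoid H) : rootComponent S ≤ rootClosure H := by
  rintro x ⟨N, hN, d, -, hx⟩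
  exact ⟨N, hN, hx ▸ d.2⟩

theorem coe_mem_rootComponent {S : Submonoid H} {d : H} (hd : d ∈ primaryComponent S) :
    (d : K) ∈ rootComponent S := ⟨1, one_pos, d, hd, by simp⟩

theorem mem_rootComponent_of_mul_mem {S : Submonoid H} {x y : K} (hx : x ∈ rootClosure H)
    (hy : y ∈ rootClosure H) (h : x * y ∈ rootComponent S) : x ∈ rootComponent S := by
  obtain ⟨m, hm, hx⟩ := hx
  obtain ⟨n, hn, hy⟩ := hy
  obtain ⟨N, hN, d, hd, hxy⟩ := h
  refine ⟨m * (n * N), by positivity, (⟨x ^ m, hx⟩ : H) ^ (n * N), ?_, by simp [pow_mul]⟩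
  refine mem_primaryComponent_of_mul_mem (b := (⟨y ^ n, hy⟩ : H) ^ (m * N)) ?_
  have : (⟨x ^ m, hx⟩ : H) ^ (n * N) * (⟨y ^ n, hy⟩ : H) ^ (m * N) = d ^ (m * n) := by
    apply Subtype.ext
    simp only [Submonoid.coe_mul, SubmonoidClass.coe_pow, ← hxy]
    rw [← pow_mul, ← pow_mul, ← pow_mul, mul_pow]
    congr 2 <;> ring
  rw [this]
  exact pow_mem hd _

/-- A non-unit of the root component of `S` does not divide any element of `S` in the root
closure. -/
theorem mul_ne_coe {S : Submonoid H} {c y : K} (hc : c ∈ rootComponent S)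
    (hcu : c⁻¹ ∉ rootClosure H) (hy : y ∈ rootClosure H) {s : H} (hs : s ∈ S) :
    c * y ≠ s := by
  intro h
  obtain ⟨N, hN, d, hd, hcd⟩ := hc
  obtain ⟨M, hM, hy⟩ := hy
  have hdvd : d ∣ 1 * s ^ (N * M) := by
    refine (dvd_pow_self d hM.ne').trans ⟨(⟨y ^ M, hy⟩ : H) ^ N, ?_⟩
    apply Subtype.ext
    simp only [one_mul, Submonoid.coe_mul, SubmonoidClass.coe_pow, ← hcd, ← h]
    rw [← pow_mul, ← pow_mul, mul_pow, mul_comm M N]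
  have hdu := isUnit_of_dvd_one (hd 1 _ (pow_mem hs _) hdvd)
  rw [isUnit_coe_iff, ← hcd, ← inv_pow] at hdu
  exact hcu ⟨N, hN, hdu⟩

/-- `p` is a non-unit of the root component of `S` of which all elements of the root component
are powers, up to units of the root closure. -/
structure IsUniformizer (S : Submonoid H) (p : K) : Prop where
  mem : p ∈ rootComponent S
  inv_notMem : p⁻¹ ∉ rootClosure H
  exists_eq : ∀ c ∈ rootComponent S, ∃ n : ℕ,
    unitClass (rootClosure H) c = unitClass (rootClosure H) p ^ n

theorem exists_isUniformizer (hwf : IsWeaklyFactorial H) (hB : IsKrull (rootClosure H))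
    {S : Submonoid H} (hS : IsMinimalPrimeCompl S) (hne : ∃ d ∈ primaryComponent S, ¬ IsUnit d) :
    ∃ p, IsUniformizer S p := by
  obtain ⟨p, hp, hp', h⟩ := hB.exists_uniformizer (rootComponent_le S)
    (fun x hx y hy => mem_rootComponent_of_mul_mem hx hy)
    (by
      rintro x ⟨m, hm, d, hd, hx⟩ y ⟨n, hn, e, he, hy⟩ hyu
      have heu : ¬ IsUnit e := by
        rw [isUnit_coe_iff, ← hy, ← inv_pow]
        exact fun h => hyu ⟨n, hn, h⟩
      obtain ⟨k, hk⟩ := hwf.exists_dvd_pow hS hd he heu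
      rw [dvd_coe_iff, SubmonoidClass.coe_pow, ← hx, ← hy] at hk
      refine ⟨n * k, mem_rootClosure_of_pow hm ?_⟩
      -- `y ^ (n k m) / x ^ m` is `y ^ (n k) / x ^ m` times a further power of `y ^ n`
      have hym : (y ^ n) ^ (k * (m - 1)) ∈ H := by
        rw [hy]
        exact pow_mem e.2 _
      have : (y ^ (n * k) * x⁻¹) ^ m = (y ^ n) ^ k * (x ^ m)⁻¹ * (y ^ n) ^ (k * (m - 1)) := by
        obtain ⟨m, rfl⟩ := Nat.exists_eq_succ_of_ne_zero hm.ne'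
        rw [mul_pow, mul_right_comm, ← pow_add, inv_pow, pow_mul, ← pow_mul]
        congr 2
        simp only [Nat.succ_sub_one, Nat.succ_eq_add_one]
        ring
      rw [this]
      exact le_rootClosure (H.mul_mem hk hym))
    (by
      obtain ⟨d, hd, hdu⟩ := hne
      exact ⟨d, coe_mem_rootComponent hd, by rwa [← isUnit_coe_iff_rootClosure]⟩)
  refine ⟨p, hp, hp', fun c hc => ?_⟩
  obtain ⟨n, hn⟩ := h c hc
  exact ⟨n, by rw [← map_pow, unitClass_eq_iff]; exact hn⟩

namespace IsUniformizer

variable {S : Submonoid H} {p : K}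

theorem mem_rootClosure (hp : IsUniformizer S p) : p ∈ rootClosure H := rootComponent_le S hp.mem

theorem pow_injective (hp : IsUniformizer S p) {k l : ℕ}
    (h : unitClass (rootClosure H) p ^ k = unitClass (rootClosure H) p ^ l) : k = l := by
  rw [← map_pow, ← map_pow, unitClass_eq_iff] at h
  exact pow_eq_of_mul_inv_mem hp.mem_rootClosure hp.inv_notMem h

/-- The exponent of `p` is well defined on products of powers of `p` with elements of `S`. -/
theorem pow_eq_of_mul_eq (hp : IsUniformizer S p) {k l : ℕ} {s t : H} (hs : s ∈ S) (ht : t ∈ S)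
    (h : unitClass (rootClosure H) p ^ k * unitClass (rootClosure H) s =
      unitClass (rootClosure H) p ^ l * unitClass (rootClosure H) t) : k = l := by
  have aux : ∀ {k l : ℕ} {s t : H}, s ∈ S → t ∈ S →
      unitClass (rootClosure H) p ^ k * unitClass (rootClosure H) s =
        unitClass (rootClosure H) p ^ l * unitClass (rootClosure H) t → l ≤ k := by
    intro k l s t hs ht h
    by_contra! hlt
    obtain ⟨m, rfl⟩ := Nat.exists_eq_add_of_lt hlt
    have h' : unitClass (rootClosure H) (p⁻¹ * s) = unitClass (rootClosure H) (p ^ m * t) := by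
      simp only [map_mul, map_pow, map_inv]
      rw [inv_mul_eq_iff_eq_mul]
      apply mul_left_cancel (a := unitClass (rootClosure H) p ^ k)
      rw [h, pow_succ, pow_add]
      ac_rfl
    refine mul_ne_coe hp.mem hp.inv_notMem (mem_of_unitClass_eq h' ?_) hs
      (mul_inv_cancel_left p (s : K))
    exact mul_mem (pow_mem hp.mem_rootClosure m) (le_rootClosure t.2)
  exact le_antisymm (aux ht hs h.symm) (aux hs ht h)

theorem mem_atomSet (hp : IsUniformizer S p) : p ∈ atomSet (rootClosure H) := by
  refine mem_atomSet_iff.2 ⟨hp.mem_rootClosure, hp.inv_notMem, fun a ha b hb hab => ?_⟩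
  have haC : a ∈ rootComponent S := mem_rootComponent_of_mul_mem ha hb (hab ▸ hp.mem)
  have hbC : b ∈ rootComponent S := mem_rootComponent_of_mul_mem hb ha
    (by rw [mul_comm, ← hab]; exact hp.mem)
  obtain ⟨i, hi⟩ := hp.exists_eq a haC
  obtain ⟨j, hj⟩ := hp.exists_eq b hbC
  have h1 : i + j = 1 := hp.pow_injective (by rw [pow_add, ← hi, ← hj, ← map_mul, ← hab, pow_one])
  rcases Nat.eq_zero_or_pos i with rfl | hi0
  · rw [pow_zero, unitClass_eq_one_iff] at hi
    exact Or.inl hi.2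
  · obtain rfl : j = 0 := by omega
    rw [pow_zero, unitClass_eq_one_iff] at hj
    exact Or.inr hj.2

theorem mem_atomSet_of_eq (hp : IsUniformizer S p) {u : K}
    (hu : unitClass (rootClosure H) u = unitClass (rootClosure H) p) :
    u ∈ atomSet (rootClosure H) := by
  have := mul_mem_atomSet hp.mem_atomSet (unitClass_eq_iff.1 hu)
  rwa [mul_comm, inv_mul_cancel_right] at this

/-- Every element of `K` is a quotient of two products of elements of the primary component
with elements of `S`. -/
theorem _root_.IsWeaklyFactorial.exists_mul_eq (hK : IsQuotientGroupOf H)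
    (hwf : IsWeaklyFactorial H) (hS : IsMinimalPrimeCompl S) (x : K) :
    ∃ d ∈ primaryComponent S, ∃ e ∈ primaryComponent S, ∃ s ∈ S, ∃ t ∈ S,
      x * ((e : K) * t) = d * s := by
  obtain ⟨a, ha, b, hb, rfl⟩ := hK x
  obtain ⟨d, hd, s, hs, hds⟩ := hwf.exists_eq_mul hS ⟨a, ha⟩
  obtain ⟨e, he, t, ht, het⟩ := hwf.exists_eq_mul hS ⟨b, hb⟩
  refine ⟨d, hd, e, he, s, hs, t, ht, ?_⟩
  rw [← Submonoid.coe_mul, ← Submonoid.coe_mul, ← hds, ← het, inv_mul_cancel_right]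

/-- A uniformizer is, up to a unit of the root closure, a quotient of two elements of the primary
component. -/
theorem exists_quotient (hp : IsUniformizer S p) (hK : IsQuotientGroupOf H)
    (hwf : IsWeaklyFactorial H) (hS : IsMinimalPrimeCompl S) :
    ∃ d ∈ primaryComponent S, ∃ e ∈ primaryComponent S, ∃ j : ℕ,
      unitClass (rootClosure H) d = unitClass (rootClosure H) p ^ (j + 1) ∧
      unitClass (rootClosure H) e = unitClass (rootClosure H) p ^ j := by
  obtain ⟨d, hd, e, he, s, hs, t, ht, h⟩ := hwf.exists_mul_eq hK hS p
  obtain ⟨i, hi⟩ := hp.exists_eq d (coe_mem_rootComponent hd)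
  obtain ⟨j, hj⟩ := hp.exists_eq e (coe_mem_rootComponent he)
  have h' := congrArg (unitClass (rootClosure H)) h
  simp only [map_mul] at h'
  rw [hi, hj, ← mul_assoc, ← pow_succ'] at h'
  obtain rfl := hp.pow_eq_of_mul_eq ht hs h'
  exact ⟨d, hd, e, he, j, hi, hj⟩

/-- If an atom `v` of the root closure has a power which is divisible in `H` by a non-unit of the
primary component, then `v` is associated to the uniformizer. -/
theorem unitClass_eq_of_mem_atomSet (hp : IsUniformizer S p) (hK : IsQuotientGroupOf H)
    (hwf : IsWeaklyFactorial H) (hS : IsMinimalPrimeCompl S) {v : K}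
    (hv : v ∈ atomSet (rootClosure H)) {N : ℕ} (hN : 0 < N) {u h : H}
    (hu : u ∈ primaryComponent S) (huu : ¬ IsUnit u) (hvN : v ^ N = (u * h : H)) :
    unitClass (rootClosure H) v = unitClass (rootClosure H) p := by
  obtain ⟨d, hd, e, he, s, hs, t, ht, hde⟩ := hwf.exists_mul_eq hK hS v
  obtain ⟨i, hi⟩ := hp.exists_eq d (coe_mem_rootComponent hd)
  obtain ⟨j, hj⟩ := hp.exists_eq e (coe_mem_rootComponent he)
  obtain ⟨d', hd', s', hs', hds'⟩ := hwf.exists_eq_mul hS (u * h)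
  obtain ⟨k, hk⟩ := hp.exists_eq d' (coe_mem_rootComponent hd')
  have hk0 : k ≠ 0 := by
    rintro rfl
    have hud : u ∣ d' := hu d' s' hs' (hds' ▸ dvd_mul_right u h)
    rw [pow_zero, unitClass_eq_one_iff] at hk
    exact huu (isUnit_of_dvd_unit hud ((isUnit_coe_iff_rootClosure d').2 hk.2))
  have hvN' : unitClass (rootClosure H) v ^ N =
      unitClass (rootClosure H) p ^ k * unitClass (rootClosure H) s' := by
    rw [← map_pow, hvN, hds', Submonoid.coe_mul, map_mul, hk]
  have hexp : k + j * N = i * N := by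
    have hde' := congrArg (fun x => unitClass (rootClosure H) x ^ N) hde
    simp only [map_mul, mul_pow] at hde'
    rw [hvN', hi, hj, ← pow_mul, ← pow_mul] at hde'
    refine hp.pow_eq_of_mul_eq (s := s' * t ^ N) (t := s ^ N) (mul_mem hs' (pow_mem ht N))
      (pow_mem hs N) ?_
    simp only [Submonoid.coe_mul, SubmonoidClass.coe_pow, map_mul, map_pow]
    rw [← hde', pow_add, mul_mul_mul_comm]
  have hij : j < i := by
    by_contra! hle
    have := Nat.mul_le_mul_right N hle
    omega
  obtain ⟨m, rfl⟩ := Nat.exists_eq_add_of_lt hij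
  -- the part of `v` prime to `p` lies in the root closure
  have hy : v * (p ^ (m + 1))⁻¹ ∈ rootClosure H := by
    refine mem_rootClosure_of_pow hN (mem_of_unitClass_eq (y := (s' : K)) ?_
      (le_rootClosure s'.2))
    rw [map_pow, map_mul, mul_pow, hvN', map_inv, map_pow, inv_pow, ← pow_mul]
    have : k = (m + 1) * N := by
      have h2 : (j + m + 1) * N = (m + 1) * N + j * N := by ring
      omega
    rw [this, mul_comm, inv_mul_cancel_left]
  obtain ⟨-, hvu, hirr⟩ := mem_atomSet_iff.1 hv
  have hmem : v * p⁻¹ ∈ rootClosure H := by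
    have : v * p⁻¹ = v * (p ^ (m + 1))⁻¹ * p ^ m := by rw [pow_succ]; group
    rw [this]
    exact mul_mem hy (pow_mem hp.mem_rootClosure m)
  rw [unitClass_eq_iff]
  exact ⟨hmem, (hirr p hp.mem_rootClosure _ hmem
    (by rw [mul_comm, inv_mul_cancel_right])).resolve_left hp.inv_notMem⟩

theorem hasUniqueLengths (hp : IsUniformizer S p) (h : atomSet H ⊆ atomSet (rootClosure H)) :
    HasUniqueLengths (primaryComponent S) := by
  refine HasUniqueLengths.of_monoidHom H.subtype hp.mem_rootClosure hp.inv_notMem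
    (fun ε hε => ?_) fun u huS hu => ?_
  · exact ⟨le_rootClosure ε.2, (isUnit_coe_iff_rootClosure ε).1 hε⟩
  · obtain ⟨n, hn⟩ := hp.exists_eq u (coe_mem_rootComponent huS)
    rw [← map_pow, unitClass_eq_iff] at hn
    exact mul_inv_mem_unitSubgroup_of_mem_atomSet (h (coe_mem_atomSet_iff.2 hu))
      hp.mem_rootClosure hp.inv_notMem hn

/-- If lengths in the primary component are unique, then all its atoms are associated to the same
power `p ^ n` in the root closure. As `p` is a quotient of two elements of the component, `n`
divides two consecutive integers. -/
theorem unitClass_eq_of_hasUniqueLengths (hp : IsUniformizer S p) (hK : IsQuotientGroupOf H)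
    (hwf : IsWeaklyFactorial H) (hat : IsAtomicMonoid H) (hS : IsMinimalPrimeCompl S)
    (hlen : HasUniqueLengths (primaryComponent S)) {u : H} (hu : Irreducible u)
    (huS : u ∈ primaryComponent S) :
    unitClass (rootClosure H) u = unitClass (rootClosure H) p := by
  obtain ⟨n, hn⟩ := hp.exists_eq u (coe_mem_rootComponent huS)
  have hatoms : ∀ w : H, Irreducible w → w ∈ primaryComponent S →
      unitClass (rootClosure H) w = unitClass (rootClosure H) p ^ n := by
    intro w hw hwS
    obtain ⟨m, hm⟩ := hp.exists_eq w (coe_mem_rootComponent hwS)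
    have heq : unitClass (rootClosure H) ((u : K) ^ m) =
        unitClass (rootClosure H) ((w : K) ^ n) := by
      rw [map_pow, map_pow, hn, hm, ← pow_mul, ← pow_mul, mul_comm]
    obtain ⟨M, hM, hMu⟩ := exists_pow_mem_unitSubgroup (unitClass_eq_iff.1 heq)
    have hassoc : Associated (u ^ (m * M)) (w ^ (n * M)) := by
      rw [associated_coe_iff, unitClass_eq_iff]
      simp only [SubmonoidClass.coe_pow]
      rwa [pow_mul, pow_mul, ← inv_pow, ← mul_pow]
    have := hlen (Multiset.replicate (m * M) u) (Multiset.replicate (n * M) w)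
      (fun x hx => Multiset.eq_of_mem_replicate hx ▸ ⟨hu, huS⟩)
      (fun x hx => Multiset.eq_of_mem_replicate hx ▸ ⟨hw, hwS⟩)
      (by simpa using hassoc)
    rw [Multiset.card_replicate, Multiset.card_replicate] at this
    rw [hm, Nat.eq_of_mul_eq_mul_right hM this]
  have hall : ∀ d ∈ primaryComponent S, ∃ k : ℕ,
      unitClass (rootClosure H) (d : K) = unitClass (rootClosure H) p ^ (n * k) := by
    intro d hd
    by_cases hdu : IsUnit d
    · refine ⟨0, ?_⟩
      rw [mul_zero, pow_zero, unitClass_eq_one_iff]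
      exact ⟨le_rootClosure d.2, (isUnit_coe_iff_rootClosure d).1 hdu⟩
    · obtain ⟨s, hs, rfl⟩ := hat d hdu
      refine Multiset.prod_induction (fun d : H => ∃ k : ℕ,
        unitClass (rootClosure H) (d : K) = unitClass (rootClosure H) p ^ (n * k)) s ?_ ?_ ?_
      · rintro a b ⟨k, hk⟩ ⟨l, hl⟩
        exact ⟨k + l, by rw [Submonoid.coe_mul, map_mul, hk, hl, mul_add, pow_add]⟩
      · exact ⟨0, by simp⟩
      · intro w hw
        exact ⟨1, by
          rw [mul_one]
          exact hatoms w (hs w hw) (mem_primaryComponent_of_dvd hd (Multiset.dvd_prod hw))⟩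
  obtain ⟨d, hd, e, he, j, hdj, hej⟩ := hp.exists_quotient hK hwf hS
  obtain ⟨k, hk⟩ := hall d hd
  obtain ⟨l, hl⟩ := hall e he
  have h1 : j + 1 = n * k := hp.pow_injective (by rw [← hdj, hk])
  have h2 : j = n * l := hp.pow_injective (by rw [← hej, hl])
  have h3 : n ∣ 1 := (Nat.dvd_add_right (h2 ▸ dvd_mul_right n l)).1 (h1 ▸ dvd_mul_right n k)
  rw [hn, Nat.dvd_one.1 h3, pow_one]

end IsUniformizer

/-- In a seminormal weakly factorial monoid, every non-unit of the root closure that is a quotient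
`a / b` of elements of the same primary component lies in the monoid: `b` divides some power
`(a / b) ^ k`, and so all large powers of `a / b` lie in the monoid. -/
theorem IsSeminormal.mul_inv_mem (hsn : IsSeminormal H) (hwf : IsWeaklyFactorial H)
    {S : Submonoid H} (hS : IsMinimalPrimeCompl S) {a b : H} (ha : a ∈ primaryComponent S)
    (hb : b ∈ primaryComponent S) (hx : (a : K) * (b : K)⁻¹ ∈ rootClosure H)
    (hxu : ((a : K) * (b : K)⁻¹)⁻¹ ∉ rootClosure H) : (a : K) * (b : K)⁻¹ ∈ H := by
  obtain ⟨N, hN, hxN⟩ := hx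
  let h : H := ⟨_, hxN⟩
  have hh : h ∈ primaryComponent S := by
    refine mem_primaryComponent_of_mul_mem (b := b ^ N) ?_
    have : h * b ^ N = a ^ N := by
      apply Subtype.ext
      simp only [h, Submonoid.coe_mul, SubmonoidClass.coe_pow]
      rw [← mul_pow, inv_mul_cancel_right]
    rw [this]
    exact pow_mem ha N
  have hhu : ¬ IsUnit h := by
    rw [isUnit_coe_iff, ← inv_pow]
    exact fun h => hxu ⟨N, hN, h⟩
  obtain ⟨m, hm⟩ := hwf.exists_dvd_pow hS hb hh hhu
  -- enlarge the exponent to make it positive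
  obtain ⟨g, hg⟩ : b ∣ h ^ (m + 1) := hm.trans (pow_dvd_pow h (Nat.le_succ m))
  have hg' : ((a : K) * (b : K)⁻¹) ^ (N * (m + 1)) = b * g := by
    rw [pow_mul, ← Submonoid.coe_mul, ← hg]
    rfl
  set k := N * (m + 1) with hkdef
  have hk : 0 < k := by positivity
  have key : (a : K) * (b : K)⁻¹ ∈ seminormalClosure H := by
    refine ⟨k * k, by positivity, fun n hn => ?_⟩
    have hr : n % k ≤ n / k := (Nat.mod_lt n hk).le.trans ((Nat.le_div_iff_mul_le hk).2 hn)
    obtain ⟨l, hl⟩ := Nat.exists_eq_add_of_le hr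
    have : ((a : K) * (b : K)⁻¹) ^ n = (b : K) ^ l * (g : K) ^ (n / k) * (a : K) ^ (n % k) := by
      conv_lhs => rw [← Nat.div_add_mod n k]
      rw [pow_add, pow_mul, hg', mul_pow, mul_pow, inv_pow]
      conv_lhs => rw [hl, pow_add]
      rw [← hl]
      generalize (b : K) ^ (n % k) = x, (b : K) ^ l = y, (g : K) ^ (n / k) = z,
        (a : K) ^ (n % k) = w
      calc _ = y * z * w * (x * x⁻¹) := by ac_rfl
        _ = _ := by rw [mul_inv_cancel, mul_one]
    rw [this]
    exact mul_mem (mul_mem (pow_mem b.2 _) (pow_mem g.2 _)) (pow_mem a.2 _)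
  rw [← hsn] at key
  exact key

theorem IsUniformizer.unitClass_eq_of_isSeminormal {S : Submonoid H} {p : K}
    (hp : IsUniformizer S p) (hK : IsQuotientGroupOf H) (hwf : IsWeaklyFactorial H)
    (hS : IsMinimalPrimeCompl S) (hsn : IsSeminormal H) {u : H} (hu : Irreducible u)
    (huS : u ∈ primaryComponent S) :
    unitClass (rootClosure H) u = unitClass (rootClosure H) p := by
  obtain ⟨d, hd, e, he, j, hdj, hej⟩ := hp.exists_quotient hK hwf hS
  have hq : unitClass (rootClosure H) ((d : K) * (e : K)⁻¹) = unitClass (rootClosure H) p := by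
    rw [map_mul, map_inv, hdj, hej, pow_succ', mul_inv_cancel_right]
  -- the quotient `q = d / e` is a uniformizer that lies in `H`
  obtain ⟨-, hqu, -⟩ := mem_atomSet_iff.1 (hp.mem_atomSet_of_eq hq)
  have hqH := hsn.mul_inv_mem hwf hS hd he (mem_of_unitClass_eq hq hp.mem_rootClosure) hqu
  obtain ⟨n, hn⟩ := hp.exists_eq u (coe_mem_rootComponent huS)
  obtain _ | _ | n := n
  · rw [pow_zero, unitClass_eq_one_iff] at hn
    exact absurd ((isUnit_coe_iff_rootClosure u).2 hn.2) hu.not_isUnit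
  · rw [hn, zero_add, pow_one]
  · exfalso
    have hqS : (⟨_, hqH⟩ : H) ∈ primaryComponent S := by
      refine mem_primaryComponent_of_mul_mem (b := e) ?_
      convert hd using 1
      exact Subtype.ext (by simp)
    have hw : unitClass (rootClosure H) ((u : K) * ((d : K) * (e : K)⁻¹)⁻¹) =
        unitClass (rootClosure H) (p ^ (n + 1)) := by
      rw [map_mul, map_inv, hq, hn, map_pow, pow_succ, mul_inv_cancel_right]
    have hwu : ((u : K) * ((d : K) * (e : K)⁻¹)⁻¹)⁻¹ ∉ rootClosure H := by
      intro h
      have hw1 : unitClass (rootClosure H) ((u : K) * ((d : K) * (e : K)⁻¹)⁻¹) = 1 :=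
        unitClass_eq_one_iff.2 ⟨mem_of_unitClass_eq hw (pow_mem hp.mem_rootClosure _), h⟩
      rw [hw, map_pow] at hw1
      exact absurd (hp.pow_injective (l := 0) (by rw [hw1, pow_zero])) (Nat.succ_ne_zero n)
    have hwH := hsn.mul_inv_mem hwf hS (a := u) (b := ⟨_, hqH⟩) huS hqS
      (mem_of_unitClass_eq hw (pow_mem hp.mem_rootClosure _)) hwu
    rcases hu.isUnit_or_isUnit (a := ⟨_, hqH⟩) (b := ⟨_, hwH⟩)
      (Subtype.ext (by rw [Submonoid.coe_mul, mul_comm, inv_mul_cancel_right])) with h | h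
    · exact hqu ((isUnit_coe_iff_rootClosure _).1 h)
    · exact hwu ((isUnit_coe_iff_rootClosure _).1 h)

end RootClosure

/-! ### Comparison with localizations -/

section Comparison

variable {M N : Type*} [CommMonoid M] [CommMonoid N] {D : Submonoid M}
  {ι : M →* N}

/-- `ι` induces an isomorphism, modulo units, of a divisor-closed submonoid `D` of `M`
with `N`. -/
structure IsReducedIso (D : Submonoid M) (ι : M →* N) : Prop where
  mem_of_dvd : ∀ a b, b ∈ D → a ∣ b → a ∈ D
  exists_associated : ∀ x : N, ∃ d ∈ D, Associated (ι d) x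
  dvd_of_dvd : ∀ d ∈ D, ∀ e ∈ D, ι d ∣ ι e → d ∣ e

namespace IsReducedIso

theorem isUnit_iff (h : IsReducedIso D ι) {d : M} (hd : d ∈ D) : IsUnit (ι d) ↔ IsUnit d :=
  ⟨fun hu => isUnit_of_dvd_one (h.dvd_of_dvd d hd 1 D.one_mem hu.dvd), fun hu => hu.map ι⟩

theorem exists_dvd_pow (h : IsReducedIso D ι)
    (hD : ∀ a ∈ D, ∀ b ∈ D, ¬ IsUnit b → ∃ n : ℕ, a ∣ b ^ n) (x y : N) (hy : ¬ IsUnit y) :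
    ∃ n : ℕ, x ∣ y ^ n := by
  obtain ⟨a, ha, hax⟩ := h.exists_associated x
  obtain ⟨b, hb, hby⟩ := h.exists_associated y
  rw [← hby.isUnit_iff, h.isUnit_iff hb] at hy
  obtain ⟨n, hn⟩ := hD a ha b hb hy
  refine ⟨n, hax.symm.dvd.trans ?_⟩
  have := map_dvd ι hn
  rw [map_pow] at this
  exact this.trans (hby.pow_pow).dvd

variable [IsCancelMul M]

theorem associated_iff (h : IsReducedIso D ι) {d e : M} (hd : d ∈ D) (he : e ∈ D) :
    Associated (ι d) (ι e) ↔ Associated d e :=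
  ⟨fun ha => associated_of_dvd_dvd_of_isCancelMul (h.dvd_of_dvd d hd e he ha.dvd)
    (h.dvd_of_dvd e he d hd ha.symm.dvd), fun ha => ha.map ι⟩

theorem irreducible_iff (h : IsReducedIso D ι) {d : M} (hd : d ∈ D) :
    Irreducible (ι d) ↔ Irreducible d := by
  constructor
  · intro hirr
    refine ⟨fun hu => hirr.not_isUnit (hu.map ι), fun a b hab => ?_⟩
    have ha : a ∈ D := h.mem_of_dvd _ _ hd (hab ▸ dvd_mul_right a b)
    have hb : b ∈ D := h.mem_of_dvd _ _ hd (hab ▸ dvd_mul_left b a)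
    rw [← h.isUnit_iff ha, ← h.isUnit_iff hb]
    exact hirr.isUnit_or_isUnit (by rw [hab, map_mul])
  · intro hirr
    refine ⟨fun hu => hirr.not_isUnit ((h.isUnit_iff hd).1 hu), fun x y hxy => ?_⟩
    obtain ⟨a, ha, hax⟩ := h.exists_associated x
    obtain ⟨b, hb, hby⟩ := h.exists_associated y
    have hab : Associated (a * b) d := by
      rw [← h.associated_iff (mul_mem ha hb) hd, map_mul, hxy]
      exact hax.mul_mul hby
    rw [← hax.isUnit_iff, ← hby.isUnit_iff, h.isUnit_iff ha, h.isUnit_iff hb]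
    exact (hab.irreducible_iff.2 hirr).isUnit_or_isUnit rfl

theorem hasUniqueLengths_iff (h : IsReducedIso D ι) :
    HasUniqueLengths (⊤ : Submonoid N) ↔ HasUniqueLengths D := by
  constructor
  · intro hN s t hs ht hst
    have key : ∀ s : Multiset M, (∀ u ∈ s, Irreducible u ∧ u ∈ D) →
        ∀ x ∈ s.map ι, Irreducible x ∧ x ∈ (⊤ : Submonoid N) := by
      intro s hs x hx
      obtain ⟨u, hu, rfl⟩ := Multiset.mem_map.1 hx
      exact ⟨(h.irreducible_iff (hs u hu).2).2 (hs u hu).1, trivial⟩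
    have := hN (s.map ι) (t.map ι) (key s hs) (key t ht) (by
      rw [← map_multiset_prod, ← map_multiset_prod]
      exact hst.map ι)
    rwa [Multiset.card_map, Multiset.card_map] at this
  · intro hD s t hs ht hst
    choose g hgD hg using h.exists_associated
    have key : ∀ s : Multiset N, (∀ x ∈ s, Irreducible x ∧ x ∈ (⊤ : Submonoid N)) →
        ∀ u ∈ s.map g, Irreducible u ∧ u ∈ D := by
      intro s hs u hu
      obtain ⟨x, hx, rfl⟩ := Multiset.mem_map.1 hu
      exact ⟨(h.irreducible_iff (hgD x)).1 ((hg x).irreducible_iff.2 (hs x hx).1), hgD x⟩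
    have hmem : ∀ s : Multiset N, (s.map g).prod ∈ D := fun s =>
      Submonoid.multiset_prod_mem _ _ fun u hu => by
        obtain ⟨x, -, rfl⟩ := Multiset.mem_map.1 hu
        exact hgD x
    have hprod : ∀ s : Multiset N, Associated (ι (s.map g).prod) s.prod := by
      intro s
      induction s using Multiset.induction_on with
      | empty => simp
      | cons x s ih =>
        rw [Multiset.map_cons, Multiset.prod_cons, Multiset.prod_cons, map_mul]
        exact (hg x).mul_mul ih
    have := hD (s.map g) (t.map g) (key s hs) (key t ht) (by
      rw [← h.associated_iff (hmem s) (hmem t)]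
      exact ((hprod s).trans hst).trans (hprod t).symm)
    rwa [Multiset.card_map, Multiset.card_map] at this

theorem isAtomicMonoid (h : IsReducedIso D ι) (hM : IsAtomicMonoid M) : IsAtomicMonoid N := by
  intro x hx
  obtain ⟨d, hd, hdx⟩ := h.exists_associated x
  rw [← hdx.isUnit_iff, h.isUnit_iff hd] at hx
  obtain ⟨s, hs, rfl⟩ := hM d hx
  obtain ⟨t, -, ht, htx⟩ := Multiset.exists_irreducible_prod_eq (s := s.map ι) (a := x)
    (fun y hy => by
      obtain ⟨u, hu, rfl⟩ := Multiset.mem_map.1 hy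
      exact (h.irreducible_iff (h.mem_of_dvd _ _ hd (Multiset.dvd_prod hu))).2 (hs u hu))
    (by rwa [← map_multiset_prod])
    (by rwa [← hdx.isUnit_iff, h.isUnit_iff hd])
  exact ⟨t, ht, htx⟩

theorem isHalfFactorial_iff (h : IsReducedIso D ι) (hM : IsAtomicMonoid M) :
    IsHalfFactorial N ↔ HasUniqueLengths D := by
  rw [_root_.isHalfFactorial_iff, h.hasUniqueLengths_iff]
  exact and_iff_right (h.isAtomicMonoid hM)

end IsReducedIso

end Comparison

section Localization

variable {K : Type*} [CommGroup K] {H : Submonoid K}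

/-- The complement of a prime `s`-ideal, as a submonoid of `H`. -/
def IsPrimeSIdeal.compl {P : Set K} (hP : IsPrimeSIdeal H P) : Submonoid H where
  carrier := {x | (x : K) ∉ P}
  one_mem' := hP.one_notMem
  mul_mem' := fun {a b} ha hb => hP.mul_notMem a a.2 b b.2 ha hb

theorem IsPrimeSIdeal.mul_mem {P : Set K} (hP : IsPrimeSIdeal H P) {x h : K} (hx : x ∈ P)
    (hh : h ∈ H) : x * h ∈ P := by
  rw [← hP.isSIdeal.2]
  exact Set.mul_mem_mul hx hh

/-- The radical of a primary element, as a subset of `K`, is a prime `s`-ideal. -/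
theorem IsPrimaryElement.isPrimeSIdeal {q : H} (hq : IsPrimaryElement q) :
    IsPrimeSIdeal H ((↑) '' radicalSet q) := by
  refine ⟨⟨?_, ?_⟩, ?_, ?_⟩
  · rintro _ ⟨x, -, rfl⟩
    exact x.2
  · ext y
    constructor
    · rintro ⟨_, ⟨x, ⟨n, hn⟩, rfl⟩, h, hh, rfl⟩
      exact ⟨x * ⟨h, hh⟩, ⟨n, by rw [mul_pow]; exact hn.mul_right _⟩, rfl⟩
    · intro hy
      exact ⟨y, hy, 1, H.one_mem, mul_one y⟩
  · rintro ⟨x, hx, hx1⟩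
    obtain rfl : x = 1 := Subtype.ext hx1
    exact (radicalCompl q hq).one_mem hx
  · rintro a ha b hb haP hbP ⟨x, hx, hxab⟩
    obtain rfl : x = ⟨a, ha⟩ * ⟨b, hb⟩ := Subtype.ext hxab
    exact (radicalCompl q hq).mul_mem (fun h => haP ⟨_, h, rfl⟩) (fun h => hbP ⟨_, h, rfl⟩) hx

theorem IsPrimeSIdeal.image_radicalSet_subset {P : Set K} (hP : IsPrimeSIdeal H P) {q : H}
    (hq : (q : K) ∈ P) : (↑) '' radicalSet q ⊆ P := by
  rintro _ ⟨x, ⟨n, c, hc⟩, rfl⟩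
  by_contra hx
  have h1 : x ^ n ∈ hP.compl := pow_mem (S := hP.compl) hx n
  rw [hc] at h1
  exact h1 (hP.mul_mem hq c.2)

theorem IsMinimalPrimeSIdeal.isMinimalPrimeCompl {P : Set K} (hP : IsMinimalPrimeSIdeal H P) :
    IsMinimalPrimeCompl hP.prop.1.compl := by
  intro q hq hqS
  have hqP : (q : K) ∈ P := not_not.1 hqS
  have hle := hP.le_of_le ⟨hq.isPrimeSIdeal, _, q, self_mem_radicalSet q, rfl⟩
    (hP.prop.1.image_radicalSet_subset hqP)
  ext x
  constructor
  · intro hx hxq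
    exact hx (hP.prop.1.image_radicalSet_subset hqP ⟨x, hxq, rfl⟩)
  · intro hx hxP
    obtain ⟨y, hy, hyx⟩ := hle hxP
    exact hx (Subtype.ext hyx ▸ hy)

theorem IsPrimaryElement.isMinimalPrimeSIdeal (hwf : IsWeaklyFactorial H) {q : H}
    (hq : IsPrimaryElement q) : IsMinimalPrimeSIdeal H ((↑) '' radicalSet q) := by
  refine ⟨⟨hq.isPrimeSIdeal, _, q, self_mem_radicalSet q, rfl⟩, ?_⟩
  rintro Q ⟨hQ, y, hy⟩ hle
  -- some primary factor `r` of an element of `Q` lies in `Q`, and it has the same radical as `q`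
  have hyu : ¬ IsUnit (⟨y, hQ.isSIdeal.1 hy⟩ : H) := by
    intro h
    have := hQ.mul_mem hy ((isUnit_coe_iff _).1 h)
    rw [mul_inv_cancel] at this
    exact hQ.one_notMem this
  obtain ⟨m, hm, hmy⟩ := hwf _ hyu
  obtain ⟨r, hr, hrQ⟩ : ∃ r ∈ m, (r : K) ∈ Q := by
    by_contra! hcon
    have h1 : m.prod ∈ hQ.compl := Submonoid.multiset_prod_mem _ _ hcon
    rw [hmy] at h1
    exact h1 hy
  have hrq : r ∈ radicalSet q := by
    obtain ⟨x, hx, hxr⟩ := hle hrQ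
    exact Subtype.ext hxr ▸ hx
  rw [← hq.radicalSet_eq (hm r hr) hrq]
  exact hQ.image_radicalSet_subset hrQ

theorem le_localizationAt {P : Set K} (hP : IsPrimeSIdeal H P) : H ≤ localizationAt H P hP :=
  fun x hx => ⟨x, hx, 1, H.one_mem, hP.one_notMem, by simp⟩

/-- Localizing at a minimal prime turns the complement into units and changes nothing else about
divisibility in the primary component. -/
theorem IsMinimalPrimeSIdeal.isReducedIso (hwf : IsWeaklyFactorial H) {P : Set K}
    (hP : IsMinimalPrimeSIdeal H P) :
    IsReducedIso (primaryComponent hP.prop.1.compl)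
      (Submonoid.inclusion (le_localizationAt hP.prop.1)) where
  mem_of_dvd _ _ hb h := mem_primaryComponent_of_dvd hb h
  exists_associated x := by
    obtain ⟨a, ha, s, hs, hsP, hx⟩ := x.2
    obtain ⟨d, hd, t, ht, hdt⟩ := hwf.exists_eq_mul hP.isMinimalPrimeCompl ⟨a, ha⟩
    refine ⟨d, hd, (associated_coe_iff _ _).2 (unitClass_eq_iff.2 ?_)⟩
    have hdt' : a = d * t := congrArg Subtype.val hdt
    rw [Submonoid.coe_inclusion, hx, hdt']
    refine ⟨⟨s, hs, t, t.2, ht, ?_⟩, ⟨t, t.2, s, hs, hsP, ?_⟩⟩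
    · rw [mul_inv, inv_inv, mul_inv, ← mul_assoc, mul_inv_cancel_left, mul_comm]
    · rw [mul_inv, inv_inv, mul_assoc, inv_mul_cancel_left]
  dvd_of_dvd d hd e _ h := by
    rw [dvd_coe_iff, Submonoid.coe_inclusion, Submonoid.coe_inclusion] at h
    obtain ⟨a, ha, s, hs, hsP, h⟩ := h
    refine hd e ⟨s, hs⟩ hsP ⟨⟨a, ha⟩, Subtype.ext ?_⟩
    rw [Submonoid.coe_mul, Submonoid.coe_mul]
    rw [mul_inv_eq_iff_eq_mul] at h
    rw [h]
    simp [mul_comm, mul_left_comm]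

end Localization

/-! ### The equivalences -/

section Equivalences

variable {K : Type*} [CommGroup K] {H : Submonoid K}

theorem IsPrimaryElement.compl_eq {q : H} (hq : IsPrimaryElement q) :
    hq.isPrimeSIdeal.compl = radicalCompl q hq := by
  ext x
  refine not_congr ⟨?_, fun hx => ⟨x, hx, rfl⟩⟩
  rintro ⟨y, hy, hyx⟩
  exact Subtype.ext hyx ▸ hy

theorem IsWeaklyFactorial.isHalfFactorial_of_primaryComponent (hwf : IsWeaklyFactorial H)
    (hat : IsAtomicMonoid H)
    (h : ∀ (u : H) (hu : IsPrimaryElement u),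
      HasUniqueLengths (primaryComponent (radicalCompl u hu))) : IsHalfFactorial H :=
  isHalfFactorial_iff.2 ⟨hat, HasUniqueLengths.of_primaryComponent
    (fun _ => hwf.isPrimaryElement_of_irreducible) fun u _ => h u _⟩

theorem IsWeaklyFactorial.isHalfFactorial_of_isTransferKrull (hwf : IsWeaklyFactorial H)
    (hat : IsAtomicMonoid H) (h : IsTransferKrull H) : IsHalfFactorial H :=
  hwf.isHalfFactorial_of_primaryComponent hat fun _ hu =>
    h.hasUniqueLengths (fun _ _ => mem_primaryComponent_of_mul_mem) fun _ ha _ hb hbu =>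
      hwf.exists_dvd_pow (isMinimalPrimeCompl_radicalCompl hu) ha hb hbu

theorem IsMinimalPrimeSIdeal.isHalfFactorial_localizationAt_iff (hwf : IsWeaklyFactorial H)
    (hat : IsAtomicMonoid H) {P : Set K} (hP : IsMinimalPrimeSIdeal H P) :
    IsHalfFactorial (localizationAt H P hP.prop.1) ↔
      HasUniqueLengths (primaryComponent hP.prop.1.compl) :=
  (hP.isReducedIso hwf).isHalfFactorial_iff hat

theorem IsMinimalPrimeSIdeal.isHalfFactorial_of_isTransferKrull (hwf : IsWeaklyFactorial H)
    (hat : IsAtomicMonoid H) {P : Set K} (hP : IsMinimalPrimeSIdeal H P)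
    (h : IsTransferKrull (localizationAt H P hP.prop.1)) :
    IsHalfFactorial (localizationAt H P hP.prop.1) := by
  have hiso := hP.isReducedIso hwf
  rw [hiso.isHalfFactorial_iff hat, ← hiso.hasUniqueLengths_iff]
  exact h.hasUniqueLengths (fun _ _ _ => trivial) fun x _ y _ hy =>
    hiso.exists_dvd_pow (fun _ ha _ hb hbu =>
      hwf.exists_dvd_pow hP.isMinimalPrimeCompl ha hb hbu) x y hy

theorem IsHalfFactorial.isHalfFactorial_localizationAt (hwf : IsWeaklyFactorial H) (h : IsHalfFactorial H)
    {P : Set K} (hP : IsMinimalPrimeSIdeal H P) :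
    IsHalfFactorial (localizationAt H P hP.prop.1) := by
  obtain ⟨hat, hlen⟩ := isHalfFactorial_iff.1 h
  exact (hP.isHalfFactorial_localizationAt_iff hwf hat).2 fun s t hs ht =>
    hlen s t (fun u hu => ⟨(hs u hu).1, trivial⟩) (fun u hu => ⟨(ht u hu).1, trivial⟩)

theorem IsWeaklyFactorial.isHalfFactorial_of_localizationAt (hwf : IsWeaklyFactorial H)
    (hat : IsAtomicMonoid H)
    (h : ∀ (P : Set K) (hP : IsMinimalPrimeSIdeal H P),
      IsHalfFactorial (localizationAt H P hP.prop.1)) : IsHalfFactorial H :=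
  hwf.isHalfFactorial_of_primaryComponent hat fun u hu => by
    have hP := hu.isMinimalPrimeSIdeal hwf
    have := (hP.isHalfFactorial_localizationAt_iff hwf hat).1 (h _ hP)
    rwa [hu.compl_eq] at this

theorem IsPrimaryElement.exists_isUniformizer (hwf : IsWeaklyFactorial H)
    (hB : IsKrull (rootClosure H)) {u : H} (hu : IsPrimaryElement u) :
    ∃ p, IsUniformizer (radicalCompl u hu) p :=
  _root_.exists_isUniformizer hwf hB (isMinimalPrimeCompl_radicalCompl hu)
    ⟨u, self_mem_primaryComponent hu, hu.1⟩

theorem IsHalfFactorial.atomSet_subset (hK : IsQuotientGroupOf H) (hwf : IsWeaklyFactorial H)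
    (hB : IsKrull (rootClosure H)) (h : IsHalfFactorial H) :
    atomSet H ⊆ atomSet (rootClosure H) := by
  obtain ⟨hat, hlen⟩ := isHalfFactorial_iff.1 h
  rintro _ ⟨u, hu, rfl⟩
  have hup := hwf.isPrimaryElement_of_irreducible hu
  obtain ⟨p, hp⟩ := hup.exists_isUniformizer hwf hB
  exact hp.mem_atomSet_of_eq (hp.unitClass_eq_of_hasUniqueLengths hK hwf hat
    (isMinimalPrimeCompl_radicalCompl hup)
    (fun s t hs ht => hlen s t (fun v hv => ⟨(hs v hv).1, trivial⟩)
      (fun v hv => ⟨(ht v hv).1, trivial⟩)) hu (self_mem_primaryComponent hup))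

theorem IsSeminormal.atomSet_subset (hK : IsQuotientGroupOf H) (hwf : IsWeaklyFactorial H)
    (hB : IsKrull (rootClosure H)) (h : IsSeminormal H) :
    atomSet H ⊆ atomSet (rootClosure H) := by
  rintro _ ⟨u, hu, rfl⟩
  have hup := hwf.isPrimaryElement_of_irreducible hu
  obtain ⟨p, hp⟩ := hup.exists_isUniformizer hwf hB
  exact hp.mem_atomSet_of_eq (hp.unitClass_eq_of_isSeminormal hK hwf
    (isMinimalPrimeCompl_radicalCompl hup) h hu (self_mem_primaryComponent hup))

theorem IsWeaklyFactorial.isHalfFactorial_of_atomSet_subset (hwf : IsWeaklyFactorial H)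
    (hB : IsKrull (rootClosure H)) (h : atomSet H ⊆ atomSet (rootClosure H)) :
    IsHalfFactorial H :=
  hwf.isHalfFactorial_of_primaryComponent hB.isAtomicMonoid_of_rootClosure fun _ hu => by
    obtain ⟨p, hp⟩ := hu.exists_isUniformizer hwf hB
    exact hp.hasUniqueLengths h

/-- If the atoms of `H` stay atoms in the root closure, then every atom `v` of the root closure is
associated to an atom of `H`, namely to any atom dividing a power of `v` that lies in `H`. -/
theorem IsWeaklyFactorial.atomSet_rootClosure_eq (hK : IsQuotientGroupOf H)
    (hwf : IsWeaklyFactorial H) (hB : IsKrull (rootClosure H))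
    (h : atomSet H ⊆ atomSet (rootClosure H)) :
    atomSet (rootClosure H) = atomSet H * unitSet (rootClosure H) := by
  refine Set.Subset.antisymm (fun v hv => ?_) ?_
  · obtain ⟨⟨N, hN, hvN⟩, hvu, -⟩ := mem_atomSet_iff.1 hv
    have hnu : ¬ IsUnit (⟨v ^ N, hvN⟩ : H) := by
      rw [isUnit_coe_iff, ← inv_pow]
      exact fun h => hvu ⟨N, hN, h⟩
    obtain ⟨s, hs, hsv⟩ := hB.isAtomicMonoid_of_rootClosure _ hnu
    obtain ⟨u, hu⟩ := Multiset.exists_mem_of_ne_zero (s := s) fun h0 =>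
      hnu (by rw [← hsv, h0, Multiset.prod_zero]; exact isUnit_one)
    obtain ⟨c, hc⟩ := Multiset.dvd_prod hu
    have huirr := hs u hu
    have hup := hwf.isPrimaryElement_of_irreducible huirr
    obtain ⟨p, hp⟩ := hup.exists_isUniformizer hwf hB
    have hvp := hp.unitClass_eq_of_mem_atomSet hK hwf (isMinimalPrimeCompl_radicalCompl hup) hv hN
      (self_mem_primaryComponent hup) hup.1 (h := c) (by rw [← hc, hsv])
    have hupp : unitClass (rootClosure H) (u : K) = unitClass (rootClosure H) p := by
      obtain ⟨n, hn⟩ := hp.exists_eq u (coe_mem_rootComponent (self_mem_primaryComponent hup))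
      rw [← map_pow, unitClass_eq_iff] at hn
      exact unitClass_eq_iff.2 (mul_inv_mem_unitSubgroup_of_mem_atomSet
        (h (coe_mem_atomSet_iff.2 huirr)) hp.mem_rootClosure hp.inv_notMem hn)
    exact ⟨u, ⟨u, huirr, rfl⟩, v * (u : K)⁻¹,
      mem_unitSet_iff.2 (unitClass_eq_iff.1 (hvp.trans hupp.symm)), by
        simp only [mul_comm (v : K), mul_inv_cancel_left]⟩
  · rintro _ ⟨u, hu, ε, hε, rfl⟩
    exact mul_mem_atomSet (h hu) (mem_unitSet_iff.1 hε)

end Equivalences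

theorem mainTheorem4 {K : Type*} [CommGroup K] (H : Submonoid K)
    (hK : IsQuotientGroupOf H) (hwf : IsWeaklyFactorial H) (hKrull : IsKrull (rootClosure H)) :
    List.TFAE
      [IsTransferKrull H,
        ∀ (P : Set K) (hP : IsMinimalPrimeSIdeal H P), IsTransferKrull (localizationAt H P hP.prop.1),
        ∀ (P : Set K) (hP : IsMinimalPrimeSIdeal H P), IsHalfFactorial (localizationAt H P hP.prop.1),
        IsHalfFactorial H,
        atomSet (rootClosure H) = atomSet H * unitSet (rootClosure H),
        atomSet H ⊆ atomSet (rootClosure H)] ∧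
    (IsSeminormal H →
      IsTransferKrull H ∧
      (∀ (P : Set K) (hP : IsMinimalPrimeSIdeal H P),
        IsTransferKrull (localizationAt H P hP.prop.1)) ∧
      (∀ (P : Set K) (hP : IsMinimalPrimeSIdeal H P),
        IsHalfFactorial (localizationAt H P hP.prop.1)) ∧
      IsHalfFactorial H ∧
      atomSet (rootClosure H) = atomSet H * unitSet (rootClosure H) ∧
      atomSet H ⊆ atomSet (rootClosure H)) := by
  have hat : IsAtomicMonoid H := hKrull.isAtomicMonoid_of_rootClosure
  have tfae : List.TFAE
      [IsTransferKrull H,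
        ∀ (P : Set K) (hP : IsMinimalPrimeSIdeal H P), IsTransferKrull (localizationAt H P hP.prop.1),
        ∀ (P : Set K) (hP : IsMinimalPrimeSIdeal H P), IsHalfFactorial (localizationAt H P hP.prop.1),
        IsHalfFactorial H,
        atomSet (rootClosure H) = atomSet H * unitSet (rootClosure H),
        atomSet H ⊆ atomSet (rootClosure H)] := by
    tfae_have 1 → 4 := hwf.isHalfFactorial_of_isTransferKrull hat
    tfae_have 4 → 1 := IsHalfFactorial.isTransferKrull
    tfae_have 4 → 3 := fun h P hP => h.isHalfFactorial_localizationAt hwf hP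
    tfae_have 3 → 4 := hwf.isHalfFactorial_of_localizationAt hat
    tfae_have 3 → 2 := fun h P hP => (h P hP).isTransferKrull
    tfae_have 2 → 3 := fun h P hP => hP.isHalfFactorial_of_isTransferKrull hwf hat (h P hP)
    tfae_have 4 → 6 := fun h => h.atomSet_subset hK hwf hKrull
    tfae_have 6 → 4 := hwf.isHalfFactorial_of_atomSet_subset hKrull
    tfae_have 6 → 5 := hwf.atomSet_rootClosure_eq hK hKrull
    tfae_have 5 → 6 := by
      intro h u hu
      rw [h]
      exact ⟨u, hu, 1, mem_unitSet_iff.2 (one_mem _), mul_one u⟩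
    tfae_finish
  refine ⟨tfae, fun hsn => ?_⟩
  have h6 := hsn.atomSet_subset hK hwf hKrull
  exact ⟨(tfae.out 0 5).2 h6, (tfae.out 1 5).2 h6, (tfae.out 2 5).2 h6, (tfae.out 3 5).2 h6,
    (tfae.out 4 5).2 h6, h6⟩
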